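/- \textsc{Undirected Path Partition} (UPP) is the following decision problem: given a finite simple undirected graph $G=(V,E)$ and an integer $k\ge 0$, are there pairwise vertex-disjoint paths $P_1,\dots,P_{k'}$ in $G$ with $k'\le k$ such that every vertex of $G$ lies on one of them? (A path is a non-empty sequence of pairwise distinct vertices in which consecutive vertices are adjacent; a single vertex is a path.) Let $\mathsf{vc}(G)$ be the vertex cover number of $G$, i.e. the smallest size of a set $S\subseteq V$ that meets every edge. \textbf{Proposition.} UPP is fixed-parameter tractable when parameterized by $\mathsf{vc}(G)$. More precisely, there is an algorithm that solves UPP in time $\mathcal{O}^*\!\left(\mathsf{vc}(G)!\cdot 2^{\mathsf{vc}(G)}\right)$: there are a program for a random access machine (with logarithmic cost) and a polynomial $p$ such that, on every instance $(G,k)$, with $G$ given by its adjacency matrix and $k$ in binary, the program halts with the correct answer after time at most $\mathsf{vc}(G)!\cdot 2^{\mathsf{vc}(G)}\cdot p(s)$, where $s$ is the size of the encoded instance. -/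

import Mathlib

/-!
# The random access machine

A structured random access machine over the natural numbers. It has registers and finitely
many (those mentioned in the program) unbounded arrays that are addressed indirectly. Time is
the logarithmic cost: every evaluated subterm is charged the bit length of its value plus one,
and every executed command and every test one further unit.
-/

namespace RAM

/-- Memory contents: `reg r` is the content of register `r`, and `mem a i` is cell `i` of
array `a`. -/
structure State where
  reg : ℕ → ℕ
  mem : ℕ → ℕ → ℕ

/-- Arithmetic operations (`sub` is truncated, `div` is integer division, with value `0` for
divisor `0`). -/
inductive Op where
  | add
  | sub
  | mul
  | div

def Op.eval : Op → ℕ → ℕ → ℕ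
  | .add, x, y => x + y
  | .sub, x, y => x - y
  | .mul, x, y => x * y
  | .div, x, y => x / y

/-- Terms: a literal, a register, the cell of array `a` at a computed address, an operation. -/
inductive Expr where
  | lit (c : ℕ)
  | reg (r : ℕ)
  | read (a : ℕ) (i : Expr)
  | bin (o : Op) (e₁ e₂ : Expr)

def Expr.eval (σ : State) : Expr → ℕ
  | .lit c => c
  | .reg r => σ.reg r
  | .read a i => σ.mem a (i.eval σ)
  | .bin o e₁ e₂ => o.eval (e₁.eval σ) (e₂.eval σ)

/-- Logarithmic cost of evaluating a term; `Nat.size` is the binary length. -/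
def Expr.cost (σ : State) : Expr → ℕ
  | .lit c => Nat.size c + 1
  | .reg r => Nat.size (σ.reg r) + 1
  | .read a i => i.cost σ + Nat.size (σ.mem a (i.eval σ)) + 1
  | .bin o e₁ e₂ =>
      e₁.cost σ + e₂.cost σ + Nat.size (o.eval (e₁.eval σ) (e₂.eval σ)) + 1

/-- Programs. -/
inductive Prog where
  | skip
  | assign (r : ℕ) (e : Expr)
  | store (a : ℕ) (i e : Expr)
  | seq (p q : Prog)
  | ifNonzero (e : Expr) (p q : Prog)
  | whileNonzero (e : Expr) (p : Prog)

/-- Write `v` into register `r`. -/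
def State.setReg (σ : State) (r v : ℕ) : State :=
  ⟨Function.update σ.reg r v, σ.mem⟩

/-- Write `v` into cell `i` of array `a`. -/
def State.setMem (σ : State) (a i v : ℕ) : State :=
  ⟨σ.reg, Function.update σ.mem a (Function.update (σ.mem a) i v)⟩

/-- `Exec p σ σ' t`: started in `σ`, the program `p` halts in `σ'` after time `t`. -/
inductive Exec : Prog → State → State → ℕ → Prop where
  | skip (σ : State) : Exec .skip σ σ 1
  | assign (σ : State) (r : ℕ) (e : Expr) :
      Exec (.assign r e) σ (σ.setReg r (e.eval σ)) (e.cost σ + 1)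
  | store (σ : State) (a : ℕ) (i e : Expr) :
      Exec (.store a i e) σ (σ.setMem a (i.eval σ) (e.eval σ)) (i.cost σ + e.cost σ + 1)
  | seq {p q : Prog} {σ σ' σ'' : State} {t t' : ℕ} :
      Exec p σ σ' t → Exec q σ' σ'' t' → Exec (.seq p q) σ σ'' (t + t')
  | if_true {e : Expr} {p q : Prog} {σ σ' : State} {t : ℕ} :
      e.eval σ ≠ 0 → Exec p σ σ' t → Exec (.ifNonzero e p q) σ σ' (e.cost σ + 1 + t)
  | if_false {e : Expr} {p q : Prog} {σ σ' : State} {t : ℕ} :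
      e.eval σ = 0 → Exec q σ σ' t → Exec (.ifNonzero e p q) σ σ' (e.cost σ + 1 + t)
  | while_true {e : Expr} {p : Prog} {σ σ' σ'' : State} {t t' : ℕ} :
      e.eval σ ≠ 0 → Exec p σ σ' t → Exec (.whileNonzero e p) σ' σ'' t' →
        Exec (.whileNonzero e p) σ σ'' (e.cost σ + 1 + t + t')
  | while_false {e : Expr} {p : Prog} {σ : State} :
      e.eval σ = 0 → Exec (.whileNonzero e p) σ σ (e.cost σ + 1)

/-- The machine is deterministic: final state and running time are determined by the start. -/
theorem Exec.deterministic {p : Prog} {σ σ₁ σ₂ : State} {t₁ t₂ : ℕ}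
    (h₁ : Exec p σ σ₁ t₁) (h₂ : Exec p σ σ₂ t₂) : σ₁ = σ₂ ∧ t₁ = t₂ := by
  induction h₁ generalizing σ₂ t₂ with
  | skip => cases h₂; exact ⟨rfl, rfl⟩
  | assign => cases h₂; exact ⟨rfl, rfl⟩
  | store => cases h₂; exact ⟨rfl, rfl⟩
  | seq _ _ ih ih' =>
    cases h₂ with
    | seq k k' =>
      obtain ⟨rfl, rfl⟩ := ih k
      obtain ⟨rfl, rfl⟩ := ih' k'
      exact ⟨rfl, rfl⟩
  | if_true h _ ih =>
    cases h₂ with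
    | if_true _ k => obtain ⟨rfl, rfl⟩ := ih k; exact ⟨rfl, rfl⟩
    | if_false h' _ => exact absurd h' h
  | if_false h _ ih =>
    cases h₂ with
    | if_true h' _ => exact absurd h h'
    | if_false _ k => obtain ⟨rfl, rfl⟩ := ih k; exact ⟨rfl, rfl⟩
  | while_true h _ _ ih ih' =>
    cases h₂ with
    | while_true _ k k' =>
      obtain ⟨rfl, rfl⟩ := ih k
      obtain ⟨rfl, rfl⟩ := ih' k'
      exact ⟨rfl, rfl⟩
    | while_false h' => exact absurd h' h
  | while_false h =>
    cases h₂ with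
    | while_true h' _ _ => exact absurd h h'
    | while_false _ => exact ⟨rfl, rfl⟩

/-- Start state on an input word: its length is in register `0`, its letters are in array `0`,
everything else is `0`. -/
def init (w : List ℕ) : State where
  reg r := if r = 0 then w.length else 0
  mem a i := if a = 0 then w.getD i 0 else 0

/-- Size of an input word: the total bit length of its letters, plus one per letter. -/
def inputSize (w : List ℕ) : ℕ :=
  (w.map fun c => Nat.size c + 1).sum

/-- `p` decides the problem `yes` (on instances `α` encoded by `enc`) within time `T`: on every
instance it halts within that time, and register `0` is nonzero at the end exactly on the
yes-instances. -/
def DecidesInTime {α : Type*} (p : Prog) (enc : α → List ℕ) (yes : α → Prop) (T : α → ℕ) :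
    Prop :=
  ∀ x : α, ∃ (σ : State) (t : ℕ),
    Exec p (init (enc x)) σ t ∧ t ≤ T x ∧ (σ.reg 0 ≠ 0 ↔ yes x)

/-- Solvability in time `O*(f)`: one program decides the problem in time `f x` times a
polynomial in the input size. -/
def SolvableInOStar {α : Type*} (enc : α → List ℕ) (yes : α → Prop) (f : α → ℕ) : Prop :=
  ∃ (p : Prog) (P : Polynomial ℕ),
    DecidesInTime p enc yes fun x => f x * P.eval (inputSize (enc x))

/-- Fixed-parameter tractability with respect to the parameter `κ`. -/
def IsFPT {α : Type*} (enc : α → List ℕ) (yes : α → Prop) (κ : α → ℕ) : Prop :=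
  ∃ f : ℕ → ℕ, Computable f ∧ SolvableInOStar enc yes fun x => f (κ x)

end RAM

/-- `G` has a partition of its vertex set into at most `k` pairwise vertex-disjoint paths. -/
def SimpleGraph.HasPathPartition {V : Type*} (G : SimpleGraph V) (k : ℕ) : Prop :=
  ∃ m ≤ k, ∃ (s t : Fin m → V) (P : ∀ i : Fin m, G.Path (s i) (t i)),
    (∀ i j : Fin m, i ≠ j → List.Disjoint (P i).1.support (P j).1.support) ∧
      ∀ v : V, ∃ i : Fin m, v ∈ (P i).1.support

/-- Instances of the problem: a finite undirected graph and a number. -/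
structure UPPInstance where
  n : ℕ
  G : SimpleGraph (Fin n)
  k : ℕ

namespace UPPInstance

/-- The question asked about an instance. -/
def IsYes (x : UPPInstance) : Prop :=
  x.G.HasPathPartition x.k

/-- The vertex cover number of the graph (Mathlib's value in `ℕ∞` is finite here). -/
noncomputable def vc (x : UPPInstance) : ℕ :=
  x.G.vertexCoverNum.toNat

open Classical in
/-- An instance as an input word: `n`, `k`, and the rows of the adjacency matrix. -/
noncomputable def encode (x : UPPInstance) : List ℕ :=
  x.n :: x.k :: (List.finRange x.n).flatMap fun i =>
    (List.finRange x.n).map fun j => if x.G.Adj i j then 1 else 0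

end UPPInstance

/-!
Write `n` for the number of vertices and `c` for the vertex cover number.

*A cover.* Going through all pairs of vertices, an uncovered edge forces one of its ends into the
cover. The binary digits of a number `W` make these choices. Counting `W` upwards, some
`W < 2 ^ (c + 1)` succeeds (`Branch.exists_run_ok`: follow a minimum cover), and a success at `W`
yields a cover `S` with `2 ^ |S| ≤ W` (`Branch.run_card`), hence with at most `c` vertices. This
takes `2 ^ c` polynomial rounds (`coverProg_runs`).

*The paths.* A partition into at most `k` paths is the same as a linear forest with at least `n - k`
edges. The vertices `v` are processed one after another; for each `v` and each `s ∈ S` the edge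
`v s` may be added, and then `v` is forgotten if it is outside `S`. As `S` is a cover, every edge
gets its turn. To know which edges may still be added it suffices to know, for the vertices of `S`
and the current `v`, whether they are ends of paths and what the other ends are: a mate function.
The other end may be a forgotten vertex, which is recorded by a ghost value. So a state is an involution
on at most `c + 1` vertices with two additional labels, and an induction on the number of
vertices bounds the number of these by `(c + 2)! * 2 ^ (c + 1)`
(`PartialInvolution.exists_finset`), a polynomial factor away from `c! * 2 ^ c`. With the number
of edges and the time as further components, the number of reachable states stays within the bound
(`Reach.exists_finset`).

*Correctness.* Every reachable state is realized by a partition into paths with the recorded number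
of edges and with ends as recorded (`Realizes`, `Reach.exists_realizes`). Conversely, the paths of a
given partition, written one after another, form a linear order of the vertices; the program
can decide to add exactly the edges between consecutive vertices, and the mate functions never stand
in the way (`Follows`, `Reach.exists_final`).

*The program.* A mate function is stored as a number with digits in base `n + 2`, so it can serve as
an array address. The reachable states are listed by a worklist, and an array indexed by
states tells which have been seen; each state costs polynomial time (`searchProg_runs`). Time is
accounted by the lemmas `Runs.of_wp` for loop-free programs and `Runs.while` for loops, which
work over memories whose values have a bounded number of bits.
-/

/-! ### Running programs with a time budget -/

namespace RAM

instance : Add Expr := ⟨.bin .add⟩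
instance : Sub Expr := ⟨.bin .sub⟩
instance : Mul Expr := ⟨.bin .mul⟩
instance : Div Expr := ⟨.bin .div⟩

@[simp] theorem Expr.eval_add (e f : Expr) (σ : State) :
    (e + f).eval σ = e.eval σ + f.eval σ := rfl
@[simp] theorem Expr.eval_sub (e f : Expr) (σ : State) :
    (e - f).eval σ = e.eval σ - f.eval σ := rfl
@[simp] theorem Expr.eval_mul (e f : Expr) (σ : State) :
    (e * f).eval σ = e.eval σ * f.eval σ := rfl
@[simp] theorem Expr.eval_div (e f : Expr) (σ : State) :
    (e / f).eval σ = e.eval σ / f.eval σ := rfl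
@[simp] theorem Expr.eval_lit (c : ℕ) (σ : State) : (Expr.lit c).eval σ = c := rfl
@[simp] theorem Expr.eval_reg (r : ℕ) (σ : State) : (Expr.reg r).eval σ = σ.reg r := rfl
@[simp] theorem Expr.eval_read (a : ℕ) (i : Expr) (σ : State) :
    (Expr.read a i).eval σ = σ.mem a (i.eval σ) := rfl

@[simp] theorem State.setReg_reg (σ : State) (r v r' : ℕ) :
    (σ.setReg r v).reg r' = if r' = r then v else σ.reg r' := by
  simp [State.setReg, Function.update_apply]

@[simp] theorem State.setReg_mem (σ : State) (r v : ℕ) : (σ.setReg r v).mem = σ.mem := rfl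

@[simp] theorem State.setMem_reg (σ : State) (a i v : ℕ) : (σ.setMem a i v).reg = σ.reg := rfl

@[simp] theorem State.setMem_mem (σ : State) (a i v a' i' : ℕ) :
    (σ.setMem a i v).mem a' i' = if a' = a ∧ i' = i then v else σ.mem a' i' := by
  by_cases h : a' = a
  · subst h; simp [State.setMem, Function.update_apply]
  · simp [State.setMem, h]

/-- All values held by the machine have at most `L` bits. -/
structure Bounded (L : ℕ) (σ : State) : Prop where
  reg : ∀ r, σ.reg r < 2 ^ L
  mem : ∀ a i, σ.mem a i < 2 ^ L

theorem Bounded.setReg {L : ℕ} {σ : State} (h : Bounded L σ) {v : ℕ} (hv : v < 2 ^ L) (r : ℕ) :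
    Bounded L (σ.setReg r v) := by
  refine ⟨fun r' => ?_, h.mem⟩
  rw [State.setReg_reg]
  split_ifs
  exacts [hv, h.reg r']

theorem Bounded.setMem {L : ℕ} {σ : State} (h : Bounded L σ) {v : ℕ} (hv : v < 2 ^ L)
    (a i : ℕ) : Bounded L (σ.setMem a i v) := by
  refine ⟨h.reg, fun a' i' => ?_⟩
  rw [State.setMem_mem]
  split_ifs
  exacts [hv, h.mem a' i']

/-- Over a memory of `L`-bit values, the value of `e` has at most `e.bits * (L + 1)` bits. -/
def Expr.bits : Expr → ℕ
  | .lit c => Nat.size c + 1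
  | .reg _ => 1
  | .read _ _ => 1
  | .bin _ e₁ e₂ => e₁.bits + e₂.bits

/-- Over a memory of `L`-bit values, evaluating `e` costs at most `e.weight * (L + 1)`. -/
def Expr.weight : Expr → ℕ
  | .lit c => Nat.size c + 1
  | .reg _ => 1
  | .read _ i => i.weight + 1
  | .bin _ e₁ e₂ => e₁.weight + e₂.weight + (e₁.bits + e₂.bits) + 1

theorem Op.eval_lt_two_pow (o : Op) {x y a b : ℕ} (hx : x < 2 ^ a) (hy : y < 2 ^ b) :
    o.eval x y < 2 ^ (a + b) := by
  have ha : 2 ^ a ≤ 2 ^ (a + b) := Nat.pow_le_pow_right (by norm_num) (by omega)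
  cases o with
  | add =>
    have h1 : (0 : ℤ) ≤ (2 ^ a - 1) * (2 ^ b - 1) := by
      apply mul_nonneg <;> linarith [one_le_pow₀ (show (1 : ℤ) ≤ 2 by norm_num) (n := a),
        one_le_pow₀ (show (1 : ℤ) ≤ 2 by norm_num) (n := b)]
    simp only [Op.eval]
    zify at *
    rw [pow_add]
    linarith
  | sub => exact lt_of_le_of_lt (Nat.sub_le _ _) (hx.trans_le ha)
  | mul =>
    simp only [Op.eval]
    rw [pow_add]
    exact Nat.mul_lt_mul'' hx hy
  | div => exact lt_of_le_of_lt (Nat.div_le_self _ _) (hx.trans_le ha)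

theorem Expr.eval_lt {L : ℕ} {σ : State} (h : Bounded L σ) (e : Expr) :
    e.eval σ < 2 ^ (e.bits * (L + 1)) := by
  induction e with
  | lit c =>
    refine lt_of_lt_of_le (Nat.lt_size_self c) (Nat.pow_le_pow_right (by norm_num) ?_)
    simp only [Expr.bits]; nlinarith [Nat.zero_le L, Nat.zero_le c.size]
  | reg r => exact (h.reg r).trans_le (Nat.pow_le_pow_right (by norm_num) (by simp [Expr.bits]))
  | read a i =>
    exact (h.mem a _).trans_le (Nat.pow_le_pow_right (by norm_num) (by simp [Expr.bits]))
  | bin o e₁ e₂ h₁ h₂ =>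
    simp only [Expr.bits, add_mul]
    exact o.eval_lt_two_pow h₁ h₂

theorem Expr.cost_le {L : ℕ} {σ : State} (h : Bounded L σ) (e : Expr) :
    e.cost σ ≤ e.weight * (L + 1) := by
  induction e with
  | lit c =>
    simp only [Expr.cost, Expr.weight]; nlinarith [Nat.zero_le L, Nat.zero_le c.size]
  | reg r => have := Nat.size_le.2 (h.reg r); simp only [Expr.cost, Expr.weight]; omega
  | read a i hi =>
    have := Nat.size_le.2 (h.mem a (i.eval σ))
    simp only [Expr.cost, Expr.weight, add_mul]; omega
  | bin o e₁ e₂ h₁ h₂ =>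
    have := Nat.size_le.2 (Expr.eval_lt h (.bin o e₁ e₂))
    simp only [Expr.eval, Expr.bits] at this
    simp only [Expr.cost, Expr.weight, add_mul] at this ⊢
    omega

/-- Started in `σ`, the program `p` halts within time `w * (L + 1)`, in a state that holds only
`L`-bit values and satisfies `Q`. -/
def Runs (L : ℕ) (p : Prog) (σ : State) (w : ℕ) (Q : State → Prop) : Prop :=
  ∃ σ' t, Exec p σ σ' t ∧ t ≤ w * (L + 1) ∧ Bounded L σ' ∧ Q σ'

theorem Runs.mono {L : ℕ} {p : Prog} {σ : State} {w w' : ℕ} {Q Q' : State → Prop}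
    (h : Runs L p σ w Q) (hw : w ≤ w') (hQ : ∀ σ', Bounded L σ' → Q σ' → Q' σ') :
    Runs L p σ w' Q' := by
  obtain ⟨σ', t, h1, h2, h3, h4⟩ := h
  exact ⟨σ', t, h1, h2.trans (Nat.mul_le_mul_right _ hw), h3, hQ _ h3 h4⟩

theorem Runs.seq {L : ℕ} {p q : Prog} {σ : State} {w w' : ℕ} {Q R : State → Prop}
    (h : Runs L p σ w Q) (h' : ∀ σ', Bounded L σ' → Q σ' → Runs L q σ' w' R) :
    Runs L (.seq p q) σ (w + w') R := by
  obtain ⟨σ', t, h1, h2, h3, h4⟩ := h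
  obtain ⟨σ'', t', k1, k2, k3, k4⟩ := h' _ h3 h4
  exact ⟨σ'', t + t', h1.seq k1, by rw [add_mul]; omega, k3, k4⟩

/-- A loop with invariant `I` whose variant `μ` decreases runs at most `μ σ` times. -/
theorem Runs.while {L : ℕ} {e : Expr} {p : Prog} {w : ℕ} (I : State → Prop) (μ : State → ℕ)
    (hbody : ∀ σ, Bounded L σ → I σ → e.eval σ ≠ 0 →
      Runs L p σ w fun σ' => I σ' ∧ μ σ' < μ σ)
    {σ : State} (hb : Bounded L σ) (hI : I σ) :
    Runs L (.whileNonzero e p) σ ((μ σ + 1) * (e.weight + 1 + w))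
      fun σ' => I σ' ∧ e.eval σ' = 0 := by
  induction hm : μ σ using Nat.strong_induction_on generalizing σ with
  | _ m ih =>
    subst hm
    have hc := Expr.cost_le hb e
    by_cases he : e.eval σ = 0
    · refine ⟨σ, _, .while_false he, ?_, hb, hI, he⟩
      have : e.cost σ + 1 ≤ (e.weight + 1 + w) * (L + 1) := by simp only [add_mul]; omega
      exact this.trans (Nat.mul_le_mul_right _ (Nat.le_mul_of_pos_left _ (by omega)))
    · obtain ⟨σ', t, h1, h2, h3, h4, h5⟩ := hbody σ hb hI he
      obtain ⟨σ'', t', k1, k2, k3, k4⟩ := ih _ h5 h3 h4 rfl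
      refine ⟨σ'', _, .while_true he h1 k1, ?_, k3, k4⟩
      have hk : t' ≤ μ σ * ((e.weight + 1 + w) * (L + 1)) := by
        rw [← mul_assoc]
        exact k2.trans (Nat.mul_le_mul_right _ (Nat.mul_le_mul_right _ (by omega)))
      have : e.cost σ + 1 + t ≤ (e.weight + 1 + w) * (L + 1) := by simp only [add_mul]; omega
      rw [mul_assoc, add_mul, one_mul]
      omega

/-- Time budget of a loop-free program, in units of `L + 1`. -/
def Prog.weight : Prog → ℕ
  | .skip => 1
  | .assign _ e => e.weight + 1
  | .store _ i e => i.weight + e.weight + 1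
  | .seq p q => p.weight + q.weight
  | .ifNonzero e p q => e.weight + 1 + (p.weight + q.weight)
  | .whileNonzero _ _ => 0

/-- Weakest precondition of a loop-free program for `Q`, including the condition that all stored
values have at most `L` bits. -/
def Prog.wp (L : ℕ) : Prog → (State → Prop) → State → Prop
  | .skip, Q, σ => Q σ
  | .assign r e, Q, σ => e.eval σ < 2 ^ L ∧ Q (σ.setReg r (e.eval σ))
  | .store a i e, Q, σ => e.eval σ < 2 ^ L ∧ Q (σ.setMem a (i.eval σ) (e.eval σ))
  | .seq p q, Q, σ => p.wp L (q.wp L Q) σ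
  | .ifNonzero e p q, Q, σ => (e.eval σ ≠ 0 → p.wp L Q σ) ∧ (e.eval σ = 0 → q.wp L Q σ)
  | .whileNonzero _ _, _, _ => False

/-- A loop-free program that meets its weakest precondition runs within its weight. -/
theorem Runs.of_wp {L : ℕ} {p : Prog} {Q : State → Prop} {σ : State} (hb : Bounded L σ)
    (h : p.wp L Q σ) : Runs L p σ p.weight Q := by
  induction p generalizing Q σ with
  | skip => exact ⟨σ, 1, .skip σ, by simp [Prog.weight], hb, h⟩
  | assign r e =>
    have := Expr.cost_le hb e
    exact ⟨_, _, .assign σ r e, by simp only [Prog.weight, add_mul]; omega, hb.setReg h.1 r, h.2⟩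
  | store a i e =>
    have := Expr.cost_le hb e
    have := Expr.cost_le hb i
    exact ⟨_, _, .store σ a i e, by simp only [Prog.weight, add_mul]; omega,
      hb.setMem h.1 a _, h.2⟩
  | seq p q hp hq => exact (hp hb h).seq fun σ' hb' h' => hq hb' h'
  | ifNonzero e p q hp hq =>
    have := Expr.cost_le hb e
    by_cases he : e.eval σ = 0
    · obtain ⟨σ', t, h1, h2, h3, h4⟩ := hq hb (h.2 he)
      exact ⟨σ', _, .if_false he h1, by simp only [Prog.weight, add_mul]; omega, h3, h4⟩
    · obtain ⟨σ', t, h1, h2, h3, h4⟩ := hp hb (h.1 he)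
      exact ⟨σ', _, .if_true he h1, by simp only [Prog.weight, add_mul]; omega, h3, h4⟩
  | whileNonzero => exact h.elim

end RAM

/-! ### Vertex covers by bounded branching -/

namespace UPPAlgorithm

/-- A stage of the greedy scan for a vertex cover: the vertices chosen so far, the branching
decisions not used so far (the binary digits of `w` below the leading one, lowest digit next),
and a flag that is `0` once a decision was missing. -/
structure Branch where
  X : Finset ℕ
  w : ℕ
  ok : ℕ

open Classical in
/-- The scan at time `t` inspects the pair `(t / n, t % n)`. An uncovered edge is covered by one of
its ends, as the next decision says. -/
noncomputable def Branch.step (A : ℕ → ℕ → Prop) (n t : ℕ) (g : Branch) : Branch :=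
  if A (t / n) (t % n) ∧ t / n ∉ g.X ∧ t % n ∉ g.X then
    if 1 < g.w then ⟨insert (if g.w % 2 = 1 then t / n else t % n) g.X, g.w / 2, g.ok⟩
    else ⟨g.X, g.w, 0⟩
  else g

/-- The scan of the `f` pairs from time `t` on. -/
noncomputable def Branch.run (A : ℕ → ℕ → Prop) (n : ℕ) : ℕ → ℕ → Branch → Branch
  | 0, _, g => g
  | f + 1, t, g => Branch.run A n f (t + 1) (g.step A n t)

variable {A : ℕ → ℕ → Prop} {n : ℕ}

theorem Branch.run_sound (f t : ℕ) (g : Branch) (h : (g.run A n f t).ok ≠ 0) :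
    g.ok ≠ 0 ∧ g.X ⊆ (g.run A n f t).X ∧ ∀ t', t ≤ t' → t' < t + f → A (t' / n) (t' % n) →
      t' / n ∈ (g.run A n f t).X ∨ t' % n ∈ (g.run A n f t).X := by
  induction f generalizing t g with
  | zero => exact ⟨h, subset_rfl, fun t' h1 h2 => by omega⟩
  | succ f ih =>
    obtain ⟨h1, h2, h3⟩ := ih (t + 1) (g.step A n t) h
    rw [Branch.run]
    have hX : g.X ⊆ (g.step A n t).X := by
      unfold Branch.step; split_ifs <;> simp
    have hcov : (g.step A n t).ok ≠ 0 → g.ok ≠ 0 ∧ (A (t / n) (t % n) →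
        t / n ∈ (g.step A n t).X ∨ t % n ∈ (g.step A n t).X) := by
      unfold Branch.step
      split_ifs with c1 c2 c3
      · simp +contextual
      · simp +contextual
      · simp
      · intro h; exact ⟨h, fun ha => by by_contra hh; push Not at hh; exact c1 ⟨ha, hh⟩⟩
    obtain ⟨k1, k2⟩ := hcov h1
    refine ⟨k1, hX.trans h2, fun t' ht ht' ha => ?_⟩
    rcases ht.eq_or_lt with rfl | ht
    · exact (k2 ha).imp (fun h => h2 h) (fun h => h2 h)
    · exact h3 t' ht (by omega) ha

theorem Branch.run_card (hA : ∀ u v, A u v → u < n ∧ v < n) (f t : ℕ) (g : Branch)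
    (hw : 1 ≤ g.w) (hg : g.X ⊆ Finset.range n) :
    2 ^ (g.run A n f t).X.card ≤ 2 ^ g.X.card * g.w ∧ (g.run A n f t).X ⊆ Finset.range n := by
  induction f generalizing t g with
  | zero => exact ⟨Nat.le_mul_of_pos_right _ hw, hg⟩
  | succ f ih =>
    rw [Branch.run]
    have : 1 ≤ (g.step A n t).w ∧ (g.step A n t).X ⊆ Finset.range n ∧
        2 ^ (g.step A n t).X.card * (g.step A n t).w ≤ 2 ^ g.X.card * g.w := by
      unfold Branch.step
      split_ifs with c1 c2 c3
      · refine ⟨by simp only; omega, Finset.insert_subset (by simp [(hA _ _ c1.1).1]) hg, ?_⟩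
        rw [Finset.card_insert_of_notMem c1.2.1, pow_succ, mul_assoc]
        exact Nat.mul_le_mul_left _ (by simp only; omega)
      · refine ⟨by simp only; omega, Finset.insert_subset (by simp [(hA _ _ c1.1).2]) hg, ?_⟩
        rw [Finset.card_insert_of_notMem c1.2.2, pow_succ, mul_assoc]
        exact Nat.mul_le_mul_left _ (by simp only; omega)
      · exact ⟨hw, hg, le_rfl⟩
      · exact ⟨hw, hg, le_rfl⟩
    obtain ⟨h1, h2⟩ := ih (t + 1) _ this.1 this.2.1
    exact ⟨h1.trans this.2.2, h2⟩

/-- Every vertex cover `C` tells how to decide so that the scan succeeds: each decision adds a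
vertex of `C`. -/
theorem Branch.exists_run_ok {C : Finset ℕ} (hC : ∀ u v, A u v → u ∈ C ∨ v ∈ C)
    (f t : ℕ) (X : Finset ℕ) :
    ∃ w, 1 ≤ w ∧ w < 2 ^ ((C \ X).card + 1) ∧ (Branch.run A n f t ⟨X, w, 1⟩).ok ≠ 0 := by
  induction f generalizing t X with
  | zero => exact ⟨1, le_rfl, Nat.one_lt_two_pow (by omega), by simp [Branch.run]⟩
  | succ f ih =>
    by_cases c : A (t / n) (t % n) ∧ t / n ∉ X ∧ t % n ∉ X
    · have key : ∀ y, y ∈ C → y ∉ X → (C \ X).card = (C \ insert y X).card + 1 := by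
        intro y hy hyX
        rw [Finset.sdiff_insert, Finset.card_erase_add_one (by simp [hy, hyX])]
      by_cases hu : t / n ∈ C
      · obtain ⟨w, h1, h2, h3⟩ := ih (t + 1) (insert (t / n) X)
        refine ⟨2 * w + 1, by omega, ?_, ?_⟩
        · rw [key _ hu c.2.1, pow_succ]; omega
        · rw [Branch.run, Branch.step, if_pos c, if_pos (by simp only; omega)]
          simpa [show (2 * w + 1) % 2 = 1 by omega, show (2 * w + 1) / 2 = w by omega] using h3
      · have hv := (hC _ _ c.1).resolve_left hu
        obtain ⟨w, h1, h2, h3⟩ := ih (t + 1) (insert (t % n) X)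
        refine ⟨2 * w, by omega, ?_, ?_⟩
        · rw [key _ hv c.2.2, pow_succ]; omega
        · rw [Branch.run, Branch.step, if_pos c, if_pos (by simp only; omega)]
          simpa using h3
    · obtain ⟨w, h1, h2, h3⟩ := ih (t + 1) X
      exact ⟨w, h1, h2, by rw [Branch.run, Branch.step, if_neg c]; exact h3⟩

/-! ### Mate functions -/

/-- The functions that agree with `base` outside `X` and on `X` are an involution labelled with
`g` and `d`: an element of `X` is mapped to `g`, to `d`, or to an element of `X` that is
mapped back to it. -/
def PartialInvolution (g d : ℕ) (X : Finset ℕ) (base m : ℕ → ℕ) : Prop :=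
  (∀ i ∉ X, m i = base i) ∧ ∀ i ∈ X, m i = g ∨ m i = d ∨ (m i ∈ X ∧ m (m i) = i)

theorem PartialInvolution.exists_finset {g d : ℕ} (X : Finset ℕ) (hg : g ∉ X) (hd : d ∉ X)
    (base : ℕ → ℕ) : ∃ F : Finset (ℕ → ℕ), (∀ m, PartialInvolution g d X base m → m ∈ F) ∧
      F.card ≤ (X.card + 1).factorial * 2 ^ X.card := by
  induction hc : X.card using Nat.strong_induction_on generalizing X base with
  | _ c ih =>
  classical
  obtain rfl | ⟨x, hx⟩ := X.eq_empty_or_nonempty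
  · refine ⟨{base}, fun m hm => ?_, by subst hc; simp⟩
    rw [Finset.mem_singleton]
    exact funext fun i => hm.1 i (by simp)
  obtain ⟨c, rfl⟩ : ∃ c', c = c' + 1 :=
    ⟨c - 1, by have := Finset.card_pos.2 ⟨x, hx⟩; omega⟩
  set Y := X.erase x with hY
  have hYc : Y.card = c := by rw [hY, Finset.card_erase_of_mem hx, hc]; rfl
  have hYX : ∀ i, i ∈ Y ↔ i ≠ x ∧ i ∈ X := fun i => Finset.mem_erase
  have hgY : g ∉ Y := fun h => hg ((hYX g).1 h).2
  have hdY : d ∉ Y := fun h => hd ((hYX d).1 h).2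
  have hgx : g ≠ x := fun h => hg (h ▸ hx)
  have hdx : d ≠ x := fun h => hd (h ▸ hx)
  choose F₁ hF₁ hF₁c using fun l : ℕ =>
    ih c (by omega) Y hgY hdY (Function.update base x l) hYc
  have hF₂ : ∀ y : ℕ, ∃ F : Finset (ℕ → ℕ), y ∈ Y → (∀ m, PartialInvolution g d (Y.erase y)
      (Function.update (Function.update base x y) y x) m → m ∈ F) ∧
        F.card ≤ (c - 1 + 1).factorial * 2 ^ (c - 1) := by
    intro y
    by_cases hy : y ∈ Y
    · have hcpos := Finset.card_pos.2 ⟨y, hy⟩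
      obtain ⟨F, hF⟩ := ih (c - 1) (by omega) (Y.erase y) (fun h => hgY (Finset.mem_of_mem_erase h))
        (fun h => hdY (Finset.mem_of_mem_erase h))
        (Function.update (Function.update base x y) y x)
        (by rw [Finset.card_erase_of_mem hy, hYc])
      exact ⟨F, fun _ => hF⟩
    · exact ⟨∅, fun h => absurd h hy⟩
  choose F₂ hF₂ using hF₂
  refine ⟨F₁ g ∪ F₁ d ∪ F₁ x ∪ Y.biUnion F₂, fun m hm => ?_, ?_⟩
  · have label : ∀ l, m x = l → l ∉ Y → m ∈ F₁ l := by
      intro l hl hlY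
      refine hF₁ l m ⟨fun i hi => ?_, fun i hi => ?_⟩
      · by_cases hix : i = x
        · subst hix; simpa using hl
        · rw [Function.update_of_ne hix]
          exact hm.1 i fun h => hi ((hYX i).2 ⟨hix, h⟩)
      · obtain ⟨hix, hiX⟩ := (hYX i).1 hi
        rcases hm.2 i hiX with h | h | ⟨h, h'⟩
        · exact .inl h
        · exact .inr (.inl h)
        · refine .inr (.inr ⟨(hYX _).2 ⟨fun e => ?_, h⟩, h'⟩)
          rw [e, hl] at h'
          exact hlY (h' ▸ hi)
    simp only [Finset.mem_union, Finset.mem_biUnion]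
    rcases hm.2 x hx with h | h | ⟨h, h'⟩
    · exact .inl (.inl (.inl (label g h hgY)))
    · exact .inl (.inl (.inr (label d h hdY)))
    · by_cases hxx : m x = x
      · exact .inl (.inr (label x hxx fun h => ((hYX x).1 h).1 rfl))
      · refine .inr ⟨m x, (hYX _).2 ⟨hxx, h⟩, ?_⟩
        set y := m x with hy
        refine (hF₂ y ((hYX _).2 ⟨hxx, h⟩)).1 m ⟨fun i hi => ?_, fun i hi => ?_⟩
        · by_cases hiy : i = y
          · subst hiy; simpa using h'
          · rw [Function.update_of_ne hiy]
            by_cases hix : i = x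
            · subst hix; simpa using hy.symm
            · rw [Function.update_of_ne hix]
              exact hm.1 i fun h => hi (Finset.mem_erase.2 ⟨hiy, (hYX i).2 ⟨hix, h⟩⟩)
        · obtain ⟨hiy, hi⟩ := Finset.mem_erase.1 hi
          obtain ⟨hix, hiX⟩ := (hYX i).1 hi
          rcases hm.2 i hiX with k | k | ⟨k, k'⟩
          · exact .inl k
          · exact .inr (.inl k)
          · refine .inr (.inr ⟨Finset.mem_erase.2 ⟨fun e => ?_, (hYX _).2 ⟨fun e => ?_, k⟩⟩, k'⟩)
            · rw [e, h'] at k'; exact hix k'.symm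
            · rw [e, ← hy] at k'; exact hiy k'.symm
  · have h1 := hF₁c g
    have h2 := hF₁c d
    have h3 := hF₁c x
    have h4 : (Y.biUnion F₂).card ≤ c * ((c - 1 + 1).factorial * 2 ^ (c - 1)) := by
      rw [← hYc]
      exact Finset.card_biUnion_le_card_mul _ _ _ fun y hy => hYc ▸ (hF₂ y hy).2
    have h5 := Finset.card_union_le (F₁ g ∪ F₁ d ∪ F₁ x) (Y.biUnion F₂)
    have h6 := Finset.card_union_le (F₁ g ∪ F₁ d) (F₁ x)
    have h7 := Finset.card_union_le (F₁ g) (F₁ d)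
    have h8 : c * ((c - 1 + 1).factorial * 2 ^ (c - 1)) ≤ (c + 1).factorial * 2 ^ c := by
      obtain rfl | ⟨c, rfl⟩ : c = 0 ∨ ∃ c', c = c' + 1 :=
        c.eq_zero_or_eq_succ_pred.imp_right fun h => ⟨_, h⟩
      · simp
      · rw [Nat.add_sub_cancel, ← mul_assoc, Nat.factorial_succ (c + 1)]
        exact Nat.mul_le_mul (Nat.mul_le_mul_right _ (by omega))
          (Nat.pow_le_pow_right (by norm_num) (by omega))
    have h9 : (c + 1 + 1).factorial * 2 ^ (c + 1) =
        2 * (c + 2) * ((c + 1).factorial * 2 ^ c) := by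
      rw [Nat.factorial_succ (c + 1), pow_succ]; ring
    rw [h9]
    have h10 := Nat.mul_le_mul_right ((c + 1).factorial * 2 ^ c) (show 4 ≤ 2 * (c + 2) by omega)
    omega

end UPPAlgorithm

/-! ### The dynamic program over mate functions -/

namespace UPPAlgorithm

/-- The value at a vertex `x < n` of a mate function `m` describes the path of the current linear
forest through `x`: the other end of that path if `x` is an end of it (and `x` itself if `x` is
isolated), the ghost value `n` if `x` is an end and the other end has been forgotten, and the value
`n + 1` if no edge may be added at `x` any more. After `t` steps the forest has `c` edges. -/
structure MateState where
  m : ℕ → ℕ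
  c : ℕ
  t : ℕ

/-- The mate function after adding an edge between `u` and `v`. The last update restores the entry
of the ghost value, which is overwritten if it is the mate of `u` or of `v`. -/
def joinMate (n : ℕ) (m : ℕ → ℕ) (u v : ℕ) : ℕ → ℕ :=
  Function.update (Function.update (Function.update (Function.update (Function.update m
    u (n + 1)) v (n + 1)) (m u) (m v)) (m v) (m u)) n n

/-- The mate function after giving up on further edges at `v`. -/
def forgetMate (n : ℕ) (m : ℕ → ℕ) (v : ℕ) : ℕ → ℕ :=
  Function.update (Function.update (Function.update (Function.update m
    (m v) n) v (n + 1)) n n) (n + 1) (n + 1)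

open Classical in
/-- One step of the dynamic program. At time `t = v * (n + 1) + s` with `s < n` the edge from `v` to
`s ∈ S` may be added, and it is if `b ≠ 0`; with `s = n` the vertex `v` is forgotten unless it
is in `S`. -/
noncomputable def MateState.next (A : ℕ → ℕ → Prop) (n : ℕ) (S : Finset ℕ) (b : ℕ)
    (q : MateState) : MateState :=
  if q.t % (n + 1) < n then
    if b ≠ 0 ∧ A (q.t / (n + 1)) (q.t % (n + 1)) ∧ q.t % (n + 1) ∈ S ∧
        q.m (q.t / (n + 1)) ≠ n + 1 ∧ q.m (q.t % (n + 1)) ≠ n + 1 ∧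
        q.m (q.t / (n + 1)) ≠ q.t % (n + 1) then
      ⟨joinMate n q.m (q.t / (n + 1)) (q.t % (n + 1)), q.c + 1, q.t + 1⟩
    else ⟨q.m, q.c, q.t + 1⟩
  else if q.t / (n + 1) ∈ S then ⟨q.m, q.c, q.t + 1⟩
  else ⟨forgetMate n q.m (q.t / (n + 1)), q.c, q.t + 1⟩

/-- The states that the dynamic program can reach. -/
inductive Reach (A : ℕ → ℕ → Prop) (n : ℕ) (S : Finset ℕ) : MateState → Prop
  | start : Reach A n S ⟨id, 0, 0⟩
  | next (b : ℕ) {q : MateState} (h : Reach A n S q) (ht : q.t < n * (n + 1)) :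
      Reach A n S (q.next A n S b)

variable {A : ℕ → ℕ → Prop} {n : ℕ} {S : Finset ℕ}

theorem MateState.next_t (b : ℕ) (q : MateState) : (q.next A n S b).t = q.t + 1 := by
  unfold MateState.next; split_ifs <;> rfl

theorem Reach.t_le {q : MateState} (h : Reach A n S q) : q.t ≤ n * (n + 1) := by
  cases h with
  | start => exact Nat.zero_le _
  | next b h ht => rw [MateState.next_t]; exact ht

theorem Reach.c_le {q : MateState} (h : Reach A n S q) : q.c ≤ q.t := by
  induction h with
  | start => exact le_rfl
  | next b h ht ih => unfold MateState.next; split_ifs <;> simp only <;> omega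

/-- The vertices that may carry information while `v` is processed: those of `S`, and `v`. -/
def active (n : ℕ) (S : Finset ℕ) (v : ℕ) : Finset ℕ :=
  if v < n then insert v S else S

theorem mem_active {v i : ℕ} : i ∈ active n S v ↔ i ∈ S ∨ (i = v ∧ v < n) := by
  unfold active; split_ifs with h <;> simp [h, or_comm]

/-- The mate function outside the active vertices: forgotten vertices admit no further edge, later
vertices are isolated. -/
def inactiveMate (n v : ℕ) (i : ℕ) : ℕ := if i < n ∧ i < v then n + 1 else i

theorem joinMate_apply (n : ℕ) (m : ℕ → ℕ) (u v i : ℕ) : joinMate n m u v i =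
    if i = n then n else if i = m v then m u else if i = m u then m v else
      if i = v ∨ i = u then n + 1 else m i := by
  unfold joinMate
  simp only [Function.update_apply]
  grind

theorem forgetMate_apply (n : ℕ) (m : ℕ → ℕ) (v i : ℕ) : forgetMate n m v i =
    if i = n + 1 then n + 1 else if i = n then n else if i = v then n + 1 else
      if i = m v then n else m i := by
  unfold forgetMate
  simp only [Function.update_apply]

theorem PartialInvolution.joinMate {X : Finset ℕ} {base m : ℕ → ℕ} {u v : ℕ}
    (hX : ∀ i ∈ X, i < n) (h : PartialInvolution n (n + 1) X base m) (hn : base n = n)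
    (hu : u ∈ X) (hv : v ∈ X) (hmu : m u ≠ n + 1) (hmv : m v ≠ n + 1)
    (huv : m u ≠ v) :
    PartialInvolution n (n + 1) X base (joinMate n m u v) := by
  obtain ⟨h1, h2⟩ := h
  have hnX : n ∉ X := fun h => lt_irrefl _ (hX n h)
  have hn1X : n + 1 ∉ X := fun h => by have := hX _ h; omega
  have hXn := hX _ hu
  have hXn' := hX _ hv
  have ku := h2 u hu
  have kv := h2 v hv
  constructor
  · intro i hi
    have := h1 i hi
    rw [joinMate_apply]
    clear h1 h2 hX
    grind
  · intro i hi
    have ki := h2 i hi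
    have kX := hX i hi
    have ka : m u ∈ X → m u < n := hX _
    have kb : m v ∈ X → m v < n := hX _
    have kc : m i ∈ X → m i < n := hX _
    simp only [joinMate_apply]
    clear h1 h2 hX
    grind

theorem Reach.partialInvolution (hS : ∀ i ∈ S, i < n) {q : MateState} (h : Reach A n S q) :
    PartialInvolution n (n + 1) (active n S (q.t / (n + 1))) (inactiveMate n (q.t / (n + 1)))
      q.m := by
  induction h with
  | start =>
    constructor
    · intro i hi; simp [inactiveMate]
    · intro i hi; exact .inr (.inr ⟨hi, rfl⟩)
  | @next b q h ht ih =>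
    have hX : ∀ i ∈ active n S (q.t / (n + 1)), i < n := by
      intro i hi; rw [mem_active] at hi; rcases hi with h | ⟨rfl, h⟩; exacts [hS i h, h]
    have hv : q.t / (n + 1) < n := (Nat.div_lt_iff_lt_mul (by omega)).2 ht
    have hdm := Nat.div_add_mod q.t (n + 1)
    have hml := Nat.mod_lt q.t (show n + 1 > 0 by omega)
    rw [MateState.next_t]
    set v := q.t / (n + 1) with hvdef
    set s := q.t % (n + 1) with hsdef
    unfold MateState.next
    rw [← hvdef, ← hsdef]
    split_ifs with c1 c2 c3
    all_goals simp only
    · rw [show (q.t + 1) / (n + 1) = v from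
        Nat.div_eq_of_lt_le (by nlinarith) (by nlinarith)]
      exact ih.joinMate hX (by simp [inactiveMate]) (mem_active.2 (.inr ⟨rfl, hv⟩))
        (mem_active.2 (.inl c2.2.2.1)) c2.2.2.2.1 c2.2.2.2.2.1 c2.2.2.2.2.2
    · rw [show (q.t + 1) / (n + 1) = v from
        Nat.div_eq_of_lt_le (by nlinarith) (by nlinarith)]
      exact ih
    · rw [show (q.t + 1) / (n + 1) = v + 1 from
        Nat.div_eq_of_lt_le (by nlinarith) (by nlinarith)]
      obtain ⟨h1, h2⟩ := ih
      simp only [mem_active] at h1 h2 ⊢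
      clear_value v s
      refine ⟨fun i hi => ?_, fun i hi => ?_⟩
      · rw [mem_active] at hi
        have := h1 i
        unfold inactiveMate at *
        grind
      · rw [mem_active] at hi
        have := h1 i
        have := h2 i
        rw [mem_active]
        unfold inactiveMate at *
        grind
    · rw [show (q.t + 1) / (n + 1) = v + 1 from
        Nat.div_eq_of_lt_le (by nlinarith) (by nlinarith)]
      obtain ⟨h1, h2⟩ := ih
      simp only [mem_active] at h1 h2 ⊢
      clear_value v s
      have hSn := hS n
      have hSn1 := hS (n + 1)
      refine ⟨fun i hi => ?_, fun i hi => ?_⟩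
      · rw [mem_active] at hi
        have := h1 i
        have := h2 v
        rw [forgetMate_apply]
        unfold inactiveMate at *
        clear h1 h2 hS hX
        grind
      · rw [mem_active] at hi
        have := h1 i
        have := h2 i
        have := h2 v
        have ka : q.m v ∈ S → q.m v < n := hS _
        have kb : q.m i ∈ S → q.m i < n := hS _
        have kc := hS i
        rw [mem_active]
        simp only [forgetMate_apply]
        unfold inactiveMate at *
        clear h1 h2 hS hX
        grind

/-- What the correctness proof needs to know about mate functions. -/
structure IsMate (n : ℕ) (m : ℕ → ℕ) : Prop where
  range : ∀ i < n, m i = n ∨ m i = n + 1 ∨ (m i < n ∧ m (m i) = i)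
  fixed : ∀ i, n ≤ i → m i = i

theorem Reach.isMate (hS : ∀ i ∈ S, i < n) {q : MateState} (h : Reach A n S q) : IsMate n q.m := by
  obtain ⟨h1, h2⟩ := h.partialInvolution hS
  have hX : ∀ i ∈ active n S (q.t / (n + 1)), i < n := by
    intro i hi; rw [mem_active] at hi; rcases hi with h | ⟨rfl, h⟩; exacts [hS i h, h]
  generalize active n S (q.t / (n + 1)) = X at *
  generalize q.t / (n + 1) = v at *
  unfold inactiveMate at h1
  constructor
  · intro i hi
    have := h1 i
    have := h2 i
    grind
  · intro i hi
    have := h1 i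
    grind

/-- There are at most `(|S| + 2)! * 2 ^ (|S| + 1)` mate functions at each time, and time and number
of edges are at most `n * (n + 1)`. -/
theorem Reach.exists_finset (hS : ∀ i ∈ S, i < n) :
    ∃ F : Finset MateState, (∀ q, Reach A n S q → q ∈ F) ∧
      F.card ≤ (n * (n + 1) + 1) ^ 2 * ((S.card + 2).factorial * 2 ^ (S.card + 1)) := by
  classical
  have hg : ∀ v, n ∉ active n S v := fun v h => by
    rw [mem_active] at h; rcases h with h | h
    · exact lt_irrefl _ (hS _ h)
    · omega
  have hd : ∀ v, n + 1 ∉ active n S v := fun v h => by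
    rw [mem_active] at h; rcases h with h | h
    · have := hS _ h; omega
    · omega
  have hcard : ∀ v, (active n S v).card ≤ S.card + 1 := fun v => by
    unfold active; split_ifs
    · exact Finset.card_insert_le _ _
    · omega
  choose F hF hFc using fun v => PartialInvolution.exists_finset (active n S v) (hg v) (hd v)
    (inactiveMate n v)
  set N := n * (n + 1) + 1
  refine ⟨(Finset.range N).biUnion fun t => (Finset.range N).biUnion fun c =>
    (F (t / (n + 1))).image fun m => ⟨m, c, t⟩, fun q hq => ?_, ?_⟩
  · have h1 := hq.t_le
    have h2 := hq.c_le
    simp only [Finset.mem_biUnion, Finset.mem_range, Finset.mem_image]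
    exact ⟨q.t, by omega, q.c, by omega, q.m, hF _ _ (hq.partialInvolution hS), rfl⟩
  · have : N ^ 2 * ((S.card + 2).factorial * 2 ^ (S.card + 1)) =
      (Finset.range N).card *
        ((Finset.range N).card * ((S.card + 2).factorial * 2 ^ (S.card + 1))) := by
      rw [Finset.card_range]; ring
    rw [this]
    refine Finset.card_biUnion_le_card_mul _ _ _ fun t _ =>
      Finset.card_biUnion_le_card_mul _ _ _ fun c _ => Finset.card_image_le.trans ?_
    refine (hFc _).trans (Nat.mul_le_mul (Nat.factorial_le ?_)
      (Nat.pow_le_pow_right (by norm_num) (hcard _)))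
    have := hcard (t / (n + 1))
    omega

end UPPAlgorithm

/-! ### Soundness of the dynamic program -/

namespace UPPAlgorithm

variable {A : ℕ → ℕ → Prop} {n : ℕ} {S : Finset ℕ}

/-- `x` and `z` are the two ends of the list `p`, in some order. -/
def EndsAt (p : List ℕ) (x z : ℕ) : Prop :=
  (p.head? = some x ∧ p.getLast? = some z) ∨ (p.head? = some z ∧ p.getLast? = some x)

/-- `P` is a partition of the vertices into paths with `c` edges in total, and `m` tells the truth
about the ends of these paths. -/
structure Realizes (A : ℕ → ℕ → Prop) (n : ℕ) (m : ℕ → ℕ) (c : ℕ)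
    (P : Multiset (List ℕ)) : Prop where
  path : ∀ p ∈ P, p ≠ [] ∧ p.IsChain A
  cover : (P.bind fun p => (p : Multiset ℕ)) = Multiset.range n
  card : Multiset.card P + c = n
  ends : ∀ x < n, m x ≠ n + 1 → ∃ p ∈ P, ∃ z, EndsAt p x z ∧ (m x = z ∨ m x = n ∧ m z = n + 1)

theorem Realizes.start : Realizes A n id 0 ((Multiset.range n).map fun i => [i]) where
  path p hp := by
    obtain ⟨i, -, rfl⟩ := Multiset.mem_map.1 hp
    exact ⟨by simp, List.isChain_singleton i⟩
  cover := by
    rw [Multiset.bind_map]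
    exact Multiset.bind_singleton _ _ |>.trans (Multiset.map_id _)
  card := by simp
  ends x hx _ := ⟨[x], Multiset.mem_map.2 ⟨x, Multiset.mem_range.2 hx, rfl⟩, x,
    .inl ⟨rfl, rfl⟩, .inl rfl⟩

theorem EndsAt.exists_reorder (hs : ∀ u v, A u v → A v u) {p : List ℕ} {x z : ℕ} (h : EndsAt p x z)
    (hp : p.IsChain A) : ∃ p' : List ℕ, (p' : Multiset ℕ) = p ∧ p'.IsChain A ∧
      p'.head? = some x ∧ p'.getLast? = some z := by
  rcases h with ⟨h1, h2⟩ | ⟨h1, h2⟩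
  · exact ⟨p, rfl, hp, h1, h2⟩
  · refine ⟨p.reverse, Multiset.coe_reverse p, ?_, by simpa using h2, by simpa using h1⟩
    rw [List.isChain_reverse]
    exact hp.imp fun a b hab => hs _ _ hab

theorem EndsAt.symm {p : List ℕ} {x z : ℕ} (h : EndsAt p x z) : EndsAt p z x := Or.symm h

theorem EndsAt.eq_or_eq {p : List ℕ} {x z x' z' : ℕ} (h : EndsAt p x z) (h' : EndsAt p x' z') :
    (x' = x ∧ z' = z) ∨ (x' = z ∧ z' = x) := by
  unfold EndsAt at h h'; grind

theorem Realizes.join (hA : ∀ u v, A u v → u < n ∧ v < n ∧ u ≠ v) (hs : ∀ u v, A u v → A v u)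
    {m : ℕ → ℕ} (hm : IsMate n m) {c : ℕ} {P : Multiset (List ℕ)} (h : Realizes A n m c P)
    {u v : ℕ} (huv : A u v) (hu : m u ≠ n + 1) (hv : m v ≠ n + 1) (hne : m u ≠ v) :
    ∃ P', Realizes A n (joinMate n m u v) (c + 1) P' := by
  obtain ⟨hun, hvn, huv'⟩ := hA u v huv
  obtain ⟨p, hp, a, hpa, ha⟩ := h.ends u hun hu
  obtain ⟨q, hq, b, hqb, hb⟩ := h.ends v hvn hv
  obtain ⟨P₁, rfl⟩ := Multiset.exists_cons_of_mem hp
  have hqp : q ≠ p := by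
    rintro rfl
    rcases hpa.eq_or_eq hqb with ⟨rfl, -⟩ | ⟨rfl, rfl⟩
    · exact huv' rfl
    · rcases ha with ha | ⟨-, ha⟩
      exacts [hne ha, hv ha]
  obtain ⟨P₀, rfl⟩ := Multiset.exists_cons_of_mem ((Multiset.mem_cons.1 hq).resolve_left hqp)
  obtain ⟨p', hp', hpc, hpl, hph⟩ := hpa.symm.exists_reorder hs (h.path p hp).2
  obtain ⟨q', hq', hqc, hql, hqh⟩ := hqb.exists_reorder hs (h.path q hq).2
  have hends : EndsAt (p' ++ q') a b := by
    left
    rw [List.head?_append, List.getLast?_append, hpl, hqh]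
    exact ⟨rfl, rfl⟩
  refine ⟨(p' ++ q') ::ₘ P₀, ⟨?_, ?_, ?_, ?_⟩⟩
  · intro r hr
    rcases Multiset.mem_cons.1 hr with rfl | hr
    · refine ⟨fun e => by simp [(List.append_eq_nil_iff.1 e).1] at hpl, ?_⟩
      rw [List.isChain_append]
      refine ⟨hpc, hqc, fun x hx y hy => ?_⟩
      rw [hph] at hx
      rw [hql] at hy
      obtain rfl : u = x := by simpa using hx
      obtain rfl : v = y := by simpa using hy
      exact huv
    · exact h.path r (by simp [hr])
  · rw [← h.cover]
    simp only [Multiset.cons_bind, ← Multiset.coe_add, hp', hq', add_assoc]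
  · have := h.card
    simp only [Multiset.card_cons] at this ⊢
    omega
  · intro x hx hmx
    have hnn := hm.fixed n le_rfl
    have hx1 := hm.range x hx
    have hu1 := hm.range u hun
    have hv1 := hm.range v hvn
    by_cases hxa : x = m u
    · refine ⟨_, Multiset.mem_cons_self _ _, b, ?_, ?_⟩
      · obtain rfl : x = a := by grind
        exact hends
      · simp only [joinMate_apply] at hmx ⊢
        grind
    by_cases hxb : x = m v
    · refine ⟨_, Multiset.mem_cons_self _ _, a, ?_, ?_⟩
      · obtain rfl : x = b := by grind
        exact hends.symm
      · simp only [joinMate_apply] at hmx ⊢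
        grind
    have hxm : joinMate n m u v x = m x := by
      rw [joinMate_apply] at hmx ⊢
      grind
    rw [hxm] at hmx ⊢
    obtain ⟨r, hr, z, hrz, hz⟩ := h.ends x hx hmx
    have hxu : x ≠ u := by
      rintro rfl; rw [joinMate_apply] at hxm; grind
    have hxv : x ≠ v := by
      rintro rfl; rw [joinMate_apply] at hxm; grind
    refine ⟨r, ?_, z, hrz, ?_⟩
    · simp only [Multiset.mem_cons] at hr ⊢
      rcases hr with rfl | rfl | hr
      · have := hpa.eq_or_eq hrz
        grind
      · have := hqb.eq_or_eq hrz
        grind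
      · exact .inr hr
    · rw [joinMate_apply]
      grind

theorem Realizes.forget {m : ℕ → ℕ} (hm : IsMate n m) {c : ℕ} {P : Multiset (List ℕ)}
    (h : Realizes A n m c P) {v : ℕ} (hv : v < n) :
    Realizes A n (forgetMate n m v) c P := by
  refine ⟨h.path, h.cover, h.card, fun x hx hmx => ?_⟩
  have hnn := hm.fixed n le_rfl
  have hnn1 := hm.fixed (n + 1) (by omega)
  have hv1 := hm.range v hv
  have hx1 := hm.range x hx
  obtain ⟨p, hp, z, hpz, hz⟩ := h.ends x hx (by rw [forgetMate_apply] at hmx; grind)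
  refine ⟨p, hp, z, hpz, ?_⟩
  simp only [forgetMate_apply] at hmx ⊢
  grind

theorem Reach.exists_realizes (hA : ∀ u v, A u v → u < n ∧ v < n ∧ u ≠ v)
    (hs : ∀ u v, A u v → A v u)
    (hS : ∀ i ∈ S, i < n) {q : MateState} (h : Reach A n S q) :
    ∃ P, Realizes A n q.m q.c P := by
  induction h with
  | start => exact ⟨_, Realizes.start⟩
  | @next b q h ht ih =>
    obtain ⟨P, hP⟩ := ih
    have hv : q.t / (n + 1) < n := (Nat.div_lt_iff_lt_mul (by omega)).2 ht
    have hm := h.isMate hS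
    unfold MateState.next
    split_ifs with c1 c2 c3
    · exact hP.join hA hs hm c2.2.1 c2.2.2.2.1 c2.2.2.2.2.1 c2.2.2.2.2.2
    · exact ⟨P, hP⟩
    · exact ⟨P, hP⟩
    · exact ⟨P, hP.forget hm hv⟩

/-! ### Completeness of the dynamic program -/

/-- A linear order of the vertices: `e` lists the vertices and `pos` gives positions. -/
structure IsOrdering (n : ℕ) (e pos : ℕ → ℕ) : Prop where
  pos_lt : ∀ x < n, pos x < n
  e_lt : ∀ i < n, e i < n
  e_pos : ∀ x < n, e (pos x) = x
  pos_e : ∀ i < n, pos (e i) = i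

/-- The vertices at positions `i` and `i + 1` are adjacent. -/
def Gap (A : ℕ → ℕ → Prop) (n : ℕ) (e : ℕ → ℕ) (i : ℕ) : Prop :=
  i + 1 < n ∧ A (e i) (e (i + 1))

/-- The state `q` arises by adding exactly the edges at the positions in `D`. They include all edges
between consecutive vertices that have had their turn; hence a vertex that admits no more edges
does not need any. -/
structure Follows (A : ℕ → ℕ → Prop) (n : ℕ) (S : Finset ℕ) (e pos : ℕ → ℕ) (q : MateState)
    (D : Finset ℕ) : Prop where
  card : D.card = q.c
  closed : ∀ x < n, q.m x = n + 1 → ∀ i, Gap A n e i → i = pos x ∨ i + 1 = pos x → i ∈ D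
  used : ∀ x < n, q.m x ≠ n + 1 → q.m x ≠ x → ∃ i ∈ D, i = pos x ∨ i + 1 = pos x
  joined : ∀ x < n, q.m x < n → ∀ j,
    pos x ≤ j ∧ j < pos (q.m x) ∨ pos (q.m x) ≤ j ∧ j < pos x → j ∈ D
  done : ∀ i, Gap A n e i → ∀ a b, a = e i ∧ b = e (i + 1) ∨ b = e i ∧ a = e (i + 1) → b ∈ S →
    a * (n + 1) + b < q.t → i ∈ D

theorem Follows.join {m e pos : ℕ → ℕ} {c t : ℕ} {D : Finset ℕ} (he : IsOrdering n e pos)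
    (hm : IsMate n m) (h : Follows A n S e pos ⟨m, c, t⟩ D) {u v i : ℕ}
    (hi : Gap A n e i) (huv : u = e i ∧ v = e (i + 1) ∨ v = e i ∧ u = e (i + 1)) (hiD : i ∉ D) :
    m u ≠ n + 1 ∧ m v ≠ n + 1 ∧ m u ≠ v ∧
      ((∀ j, Gap A n e j → ∀ a b, a = e j ∧ b = e (j + 1) ∨ b = e j ∧ a = e (j + 1) →
        b ∈ S → a * (n + 1) + b < t + 1 → j ∈ insert i D) →
      Follows A n S e pos ⟨joinMate n m u v, c + 1, t + 1⟩ (insert i D)) := by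
  obtain ⟨hcard, hclosed, hused, hjoined, -⟩ := h
  simp only at hcard hclosed hused hjoined
  have hi1 : i + 1 < n := hi.1
  have hp : pos u = i ∧ pos v = i + 1 ∨ pos v = i ∧ pos u = i + 1 := by
    have := he.pos_e i (by omega)
    have := he.pos_e (i + 1) hi1
    grind
  have hun : u < n := by
    have := he.e_lt i (by omega)
    have := he.e_lt (i + 1) hi1
    grind
  have hvn : v < n := by
    have := he.e_lt i (by omega)
    have := he.e_lt (i + 1) hi1
    grind
  have hne : u ≠ v := by rintro rfl; omega
  have hu : m u ≠ n + 1 := fun h => hiD (hclosed u hun h i hi (by omega))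
  have hv : m v ≠ n + 1 := fun h => hiD (hclosed v hvn h i hi (by omega))
  have hmuv : m u ≠ v := fun h => hiD (hjoined u hun (by omega) i (by rw [h]; omega))
  have ku := hm.range u hun
  have kv := hm.range v hvn
  have kn := hm.fixed n le_rfl
  refine ⟨hu, hv, hmuv, fun hdone => ⟨?_, ?_, ?_, ?_, hdone⟩⟩
  · rw [Finset.card_insert_of_notMem hiD, hcard]
  · -- a vertex that the new edge closes has a gap in `D` on one side and the gap `i` on the other
    intro x hx hmx j hj hjx
    have hpx : x = u ∨ x = v → pos x = i ∨ pos x = i + 1 := by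
      clear hmx hj
      rintro (rfl | rfl) <;> omega
    have ux := hused x hx
    have cx := hclosed x hx
    simp only [joinMate_apply] at hmx
    rw [Finset.mem_insert]
    by_cases hxu : x = u ∨ x = v
    · have hxm : m x ≠ n + 1 ∧ m x ≠ x := by
        rcases hxu with rfl | rfl <;> grind
      obtain ⟨i', hi', hix⟩ := ux hxm.1 hxm.2
      by_cases hji : j = i
      · exact .inl hji
      · have hii : i' ≠ i := fun e => hiD (e ▸ hi')
        have := hpx hxu
        clear ux cx hmx
        have : j = i' := by omega
        exact .inr (this ▸ hi')
    · exact .inr (cx (by grind) j hj hjx)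
  · intro x hx h1 h2
    simp only [Finset.mem_insert, joinMate_apply] at h1 h2 ⊢
    by_cases hxu : x = u ∨ x = v
    · exact ⟨i, .inl rfl, by rcases hxu with rfl | rfl <;> omega⟩
    · obtain ⟨i', hi', hix⟩ := hused x hx (by grind) (by grind)
      exact ⟨i', .inr hi', hix⟩
  · intro x hx hmx j hj
    simp only [joinMate_apply] at hmx hj
    rw [Finset.mem_insert]
    have jx := hjoined x hx
    have ju := hjoined u hun
    have jv := hjoined v hvn
    by_cases hji : j = i
    · exact .inl hji
    · right
      by_cases hxa : x = m u
      · have hxb : x ≠ m v := by grind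
        rw [if_neg (by omega), if_neg hxb, if_pos hxa] at hj hmx
        by_cases k : pos u ≤ j ∧ j < pos x ∨ pos x ≤ j ∧ j < pos u
        · exact ju (by omega) j (by rw [← hxa]; exact k)
        · exact jv hmx j (by omega)
      by_cases hxb : x = m v
      · rw [if_neg (by omega), if_pos hxb] at hj hmx
        by_cases k : pos u ≤ j ∧ j < pos (m u) ∨ pos (m u) ≤ j ∧ j < pos u
        · exact ju hmx j k
        · exact jv (by omega) j (by rw [← hxb]; omega)
      · rw [if_neg (by omega), if_neg hxb, if_neg hxa] at hj hmx
        by_cases hxu : x = v ∨ x = u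
        · rw [if_pos hxu] at hmx; omega
        · rw [if_neg hxu] at hj hmx
          exact jx hmx j hj

theorem Follows.forget {m e pos : ℕ → ℕ} {c t : ℕ} {D : Finset ℕ}
    (hm : IsMate n m) (h : Follows A n S e pos ⟨m, c, t⟩ D) {v : ℕ} (hv : v < n)
    (hvD : ∀ i, Gap A n e i → i = pos v ∨ i + 1 = pos v → i ∈ D)
    (hdone : ∀ i, Gap A n e i → ∀ a b, a = e i ∧ b = e (i + 1) ∨ b = e i ∧ a = e (i + 1) →
      b ∈ S → a * (n + 1) + b < t + 1 → i ∈ D) :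
    Follows A n S e pos ⟨forgetMate n m v, c, t + 1⟩ D := by
  obtain ⟨hcard, hclosed, hused, hjoined, -⟩ := h
  simp only at hcard hclosed hused hjoined
  have kv := hm.range v hv
  refine ⟨hcard, fun x hx h1 => ?_, fun x hx h1 h2 => ?_, fun x hx h1 => ?_, hdone⟩
  · simp only [forgetMate_apply] at h1
    by_cases hxv : x = v
    · rw [hxv]; exact hvD
    · exact hclosed x hx (by grind)
  · simp only [forgetMate_apply] at h1 h2
    exact hused x hx (by grind) (by grind)
  · have : forgetMate n m v x = m x := by
      simp only [forgetMate_apply] at h1 ⊢; grind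
    simp only [this] at h1 ⊢
    exact hjoined x hx h1

/-- Some choice of the bit makes the dynamic program follow the given order for another step. -/
theorem Follows.exists_next (hA : ∀ u v, A u v → u < n ∧ v < n ∧ u ≠ v) (hs : ∀ u v, A u v → A v u)
    (hS : ∀ i ∈ S, i < n) (hcov : ∀ u v, A u v → u ∈ S ∨ v ∈ S) {e pos : ℕ → ℕ}
    (he : IsOrdering n e pos) {q : MateState} (hq : Reach A n S q) (ht : q.t < n * (n + 1))
    {D : Finset ℕ} (h : Follows A n S e pos q D) :
    ∃ b < 2, ∃ D', Follows A n S e pos (q.next A n S b) D' := by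
  have hv : q.t / (n + 1) < n := (Nat.div_lt_iff_lt_mul (by omega)).2 ht
  have hm := hq.isMate hS
  have hdm := Nat.div_add_mod q.t (n + 1)
  have hml := Nat.mod_lt q.t (show n + 1 > 0 by omega)
  obtain ⟨m, c, t⟩ := q
  unfold MateState.next
  simp only at *
  set v := t / (n + 1) with hvdef
  set s := t % (n + 1) with hsdef
  -- the pair inspected at time `t` is the only one that gets its turn now
  have hpair : ∀ a b, b < n → a * (n + 1) + b < t + 1 → a * (n + 1) + b < t ∨ (a = v ∧ b = s) := by
    intro a b hb hlt
    by_cases h : a * (n + 1) + b = t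
    · right
      rw [hvdef, hsdef, ← h]
      exact ⟨(Nat.div_eq_of_lt_le (by omega) (by nlinarith)).symm, by
        rw [mul_comm, Nat.mul_add_mod, Nat.mod_eq_of_lt (by omega)]⟩
    · left; omega
  by_cases hsn : s < n
  · simp only [if_pos hsn]
    by_cases hi : ∃ i, Gap A n e i ∧ (v = e i ∧ s = e (i + 1) ∨ s = e i ∧ v = e (i + 1)) ∧
        i ∉ D ∧ s ∈ S
    · obtain ⟨i, hi, hvs, hiD, hsS⟩ := hi
      obtain ⟨h1, h2, h3, h4⟩ := h.join he hm hi hvs hiD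
      have hAvs : A v s := by
        rcases hvs with ⟨h5, h6⟩ | ⟨h5, h6⟩
        · rw [h5, h6]; exact hi.2
        · rw [h5, h6]; exact hs _ _ hi.2
      refine ⟨1, by omega, insert i D, ?_⟩
      rw [if_pos ⟨one_ne_zero, hAvs, hsS, h1, h2, h3⟩]
      refine h4 fun j hj a b hab hb hlt => ?_
      rcases hpair a b (hS b hb) hlt with hlt | ⟨rfl, rfl⟩
      · exact Finset.mem_insert_of_mem (h.done j hj a b hab hb hlt)
      · have e1 := he.pos_e i (by have := hi.1; omega)
        have e2 := he.pos_e (i + 1) hi.1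
        have e3 := he.pos_e j (by have := hj.1; omega)
        have e4 := he.pos_e (j + 1) hj.1
        have : j = i := by
          clear_value v s
          rcases hvs with ⟨h5, h6⟩ | ⟨h5, h6⟩ <;> rcases hab with ⟨h7, h8⟩ | ⟨h7, h8⟩ <;>
            have a1 := congrArg pos h5 <;> have a2 := congrArg pos h6 <;>
            have a3 := congrArg pos h7 <;> have a4 := congrArg pos h8 <;> omega
        rw [this]; exact Finset.mem_insert_self _ _
    · refine ⟨0, by omega, D, ?_⟩
      rw [if_neg (by simp)]
      refine ⟨h.card, h.closed, h.used, h.joined, fun j hj a b hab hb hlt => ?_⟩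
      rcases hpair a b (hS b hb) hlt with hlt | ⟨rfl, rfl⟩
      · exact h.done j hj a b hab hb hlt
      · by_contra hjD
        exact hi ⟨j, hj, hab, hjD, hb⟩
  · have hdone : ∀ i, Gap A n e i → ∀ a b, a = e i ∧ b = e (i + 1) ∨ b = e i ∧ a = e (i + 1) →
        b ∈ S → a * (n + 1) + b < t + 1 → i ∈ D := by
      intro j hj a b hab hb hlt
      rcases hpair a b (hS b hb) hlt with hlt | ⟨rfl, rfl⟩
      · exact h.done j hj a b hab hb hlt
      · exact absurd (hS _ hb) hsn
    refine ⟨0, by omega, D, ?_⟩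
    simp only [if_neg hsn]
    by_cases hvS : v ∈ S
    · rw [if_pos hvS]
      exact ⟨h.card, h.closed, h.used, h.joined, hdone⟩
    · rw [if_neg hvS]
      refine h.forget hm hv (fun i hi hiv => ?_) hdone
      -- the neighbours of `v` are in `S`, so all its edges have had their turn
      have hlt : ∀ b, A v b → v * (n + 1) + b < t := fun b hb => by
        have := (hA v b hb).2.1
        nlinarith
      rcases hiv with hiv | hiv
      · have ev : e i = v := by rw [hiv]; exact he.e_pos v hv
        have hAvb : A v (e (i + 1)) := ev ▸ hi.2
        exact h.done i hi v (e (i + 1)) (.inl ⟨ev.symm, rfl⟩)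
          ((hcov _ _ hAvb).resolve_left hvS) (hlt _ hAvb)
      · have ev : e (i + 1) = v := by rw [hiv]; exact he.e_pos v hv
        have hAvb : A v (e i) := hs _ _ (ev ▸ hi.2)
        exact h.done i hi v (e i) (.inr ⟨rfl, ev.symm⟩)
          ((hcov _ _ hAvb).resolve_left hvS) (hlt _ hAvb)

/-- The dynamic program can pick up all edges between consecutive vertices of a linear order. -/
theorem Reach.exists_final (hA : ∀ u v, A u v → u < n ∧ v < n ∧ u ≠ v) (hs : ∀ u v, A u v → A v u)
    (hS : ∀ i ∈ S, i < n) (hcov : ∀ u v, A u v → u ∈ S ∨ v ∈ S) {e pos : ℕ → ℕ}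
    (he : IsOrdering n e pos) (R : MateState → Prop) (hR₀ : R ⟨id, 0, 0⟩)
    (hR : ∀ q, Reach A n S q → R q → q.t < n * (n + 1) → ∀ b < 2, R (q.next A n S b))
    (E : Finset ℕ) (hE : ∀ i ∈ E, Gap A n e i) :
    ∃ q, R q ∧ q.t = n * (n + 1) ∧ E.card ≤ q.c := by
  have key : ∀ t ≤ n * (n + 1), ∃ q D, Reach A n S q ∧ R q ∧ q.t = t ∧
      Follows A n S e pos q D := by
    intro t
    induction t with
    | zero =>
      intro _
      refine ⟨⟨id, 0, 0⟩, ∅, .start, hR₀, rfl, rfl, ?_, ?_, ?_, ?_⟩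
      · intro x hx h; simp only [id] at h; omega
      · intro x hx _ h; exact absurd rfl h
      · intro x hx _ j h; simp only [id] at h; omega
      · intro i hi a b _ _ h; simp at h
    | succ t ih =>
      intro ht
      obtain ⟨q, D, h1, h2, rfl, h4⟩ := ih (by omega)
      obtain ⟨b, hb, D', hD'⟩ := h4.exists_next hA hs hS hcov he h1 ht
      exact ⟨_, D', .next b h1 ht, hR q h1 h2 ht b hb, q.next_t b, hD'⟩
  obtain ⟨q, D, h1, h2, h3, h4⟩ := key _ le_rfl
  refine ⟨q, h2, h3, ?_⟩
  rw [← h4.card]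
  refine Finset.card_le_card fun i hi => ?_
  have hg := hE i hi
  have hlt : ∀ a b, a < n → b < n → a * (n + 1) + b < q.t := fun a b ha hb => by
    rw [h3]; nlinarith
  have ha := he.e_lt i (by have := hg.1; omega)
  have hb := he.e_lt (i + 1) hg.1
  rcases hcov _ _ hg.2 with h | h
  · exact h4.done i hg _ _ (.inr ⟨rfl, rfl⟩) h (hlt _ _ hb ha)
  · exact h4.done i hg _ _ (.inl ⟨rfl, rfl⟩) h (hlt _ _ ha hb)

end UPPAlgorithm

/-! ### Path partitions, orders and vertex covers of an instance -/

namespace UPPAlgorithm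

open Classical in
/-- The number of places where consecutive entries of a list are adjacent. -/
noncomputable def gapCount (A : ℕ → ℕ → Prop) : List ℕ → ℕ
  | [] => 0
  | [_] => 0
  | a :: b :: l => (if A a b then 1 else 0) + gapCount A (b :: l)

variable {A : ℕ → ℕ → Prop}

theorem gapCount_le_cons (a : ℕ) (l : List ℕ) : gapCount A l ≤ gapCount A (a :: l) := by
  cases l with
  | nil => simp [gapCount]
  | cons b l => rw [gapCount]; omega

theorem length_add_gapCount_le (l r : List ℕ) (hl : l ≠ []) (hc : l.IsChain A) :
    l.length + gapCount A r ≤ gapCount A (l ++ r) + 1 := by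
  induction l with
  | nil => exact absurd rfl hl
  | cons a l ih =>
    cases l with
    | nil => have := gapCount_le_cons (A := A) a r; simp; omega
    | cons b l =>
      rw [List.isChain_cons_cons] at hc
      have := ih (by simp) hc.2
      simp only [List.cons_append, List.length_cons] at this ⊢
      rw [gapCount, if_pos hc.1]
      omega

theorem length_flatten_le_gapCount (L : List (List ℕ)) (h : ∀ l ∈ L, l ≠ [] ∧ l.IsChain A) :
    L.flatten.length ≤ gapCount A L.flatten + L.length := by
  induction L with
  | nil => simp
  | cons l L ih =>
    have h1 := ih fun l' hl' => h l' (by simp [hl'])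
    obtain ⟨h2, h3⟩ := h l (by simp)
    have h4 := length_add_gapCount_le l L.flatten h2 h3
    simp only [List.flatten_cons, List.length_append, List.length_cons]
    omega

theorem exists_finset_gapCount (l : List ℕ) : ∃ E : Finset ℕ, E.card = gapCount A l ∧
    ∀ i ∈ E, Gap A l.length (fun i => l.getD i 0) i := by
  induction l with
  | nil => exact ⟨∅, rfl, by simp⟩
  | cons a l ih =>
    cases l with
    | nil => exact ⟨∅, rfl, by simp⟩
    | cons b l =>
      obtain ⟨E, hE, hg⟩ := ih
      have hsucc : ∀ i ∈ E.map (addRightEmbedding 1),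
          Gap A (a :: b :: l).length (fun i => (a :: b :: l).getD i 0) i := by
        intro i hi
        obtain ⟨j, hj, rfl⟩ := Finset.mem_map.1 hi
        obtain ⟨h1, h2⟩ := hg j hj
        exact ⟨by simpa using h1, by simpa using h2⟩
      by_cases hab : A a b
      · refine ⟨insert 0 (E.map (addRightEmbedding 1)), ?_, fun i hi => ?_⟩
        · rw [Finset.card_insert_of_notMem (by simp), Finset.card_map, gapCount, if_pos hab]
          omega
        · rcases Finset.mem_insert.1 hi with rfl | hi
          · exact ⟨by simp, by simpa using hab⟩
          · exact hsucc i hi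
      · refine ⟨E.map (addRightEmbedding 1), ?_, hsucc⟩
        rw [Finset.card_map, gapCount, if_neg hab]
        omega

/-- Adjacency of two vertices, given by their numbers. -/
def Adjacent (x : UPPInstance) (i j : ℕ) : Prop :=
  ∃ (hi : i < x.n) (hj : j < x.n), x.G.Adj ⟨i, hi⟩ ⟨j, hj⟩

variable {x : UPPInstance}

theorem Adjacent.lt_lt_ne (u v : ℕ) (h : Adjacent x u v) : u < x.n ∧ v < x.n ∧ u ≠ v := by
  obtain ⟨hu, hv, h⟩ := h
  exact ⟨hu, hv, fun e => h.ne (Fin.ext e)⟩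

theorem Adjacent.symm (u v : ℕ) (h : Adjacent x u v) : Adjacent x v u := by
  obtain ⟨hu, hv, h⟩ := h
  exact ⟨hv, hu, h.symm⟩

theorem isYes_of_realizes {m : ℕ → ℕ} {c : ℕ} {P : Multiset (List ℕ)}
    (h : Realizes (Adjacent x) x.n m c P) (hc : x.n ≤ c + x.k) : x.IsYes := by
  obtain ⟨L, rfl⟩ := Quot.exists_rep P
  have hflat : (L.flatten : Multiset ℕ) = Multiset.range x.n := by
    rw [← h.cover]
    have := Multiset.coe_bind L fun l => l
    rw [List.flatMap_id'] at this
    exact this.symm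
  have hnodup : L.flatten.Nodup := by
    rw [← Multiset.coe_nodup, hflat]; exact Multiset.nodup_range _
  have hmem : ∀ v, v ∈ L.flatten ↔ v < x.n := fun v => by
    rw [← Multiset.mem_coe, hflat, Multiset.mem_range]
  have hcard : L.length + c = x.n := h.card
  rw [List.nodup_flatten] at hnodup
  obtain ⟨hn1, hn2⟩ := hnodup
  rcases Nat.eq_zero_or_pos x.n with h0 | hpos
  · exact ⟨0, Nat.zero_le _, Fin.elim0, Fin.elim0, fun i => i.elim0, fun i => i.elim0,
      fun v => absurd v.2 (by omega)⟩
  let f : ℕ → Fin x.n := fun j => ⟨j % x.n, Nat.mod_lt _ hpos⟩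
  have hf : ∀ j (hj : j < x.n), f j = ⟨j, hj⟩ := fun j hj => Fin.ext (Nat.mod_eq_of_lt hj)
  have hlt : ∀ l ∈ L, ∀ v ∈ l, v < x.n := fun l hl v hv =>
    (hmem v).1 (List.mem_flatten.2 ⟨l, hl, hv⟩)
  have hfinj : ∀ l ∈ L, ∀ l' ∈ L, ∀ a ∈ l, ∀ b ∈ l', f a = f b → a = b := by
    intro l hl l' hl' a ha b hb e
    rw [hf a (hlt l hl a ha), hf b (hlt l' hl' b hb)] at e
    exact Fin.mk.inj e
  have hne : ∀ i : Fin L.length, (L[i]).map f ≠ [] := fun i => by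
    simpa using (h.path _ (List.getElem_mem i.2)).1
  have hch : ∀ i : Fin L.length, ((L[i]).map f).IsChain x.G.Adj := fun i => by
    rw [List.isChain_map]
    refine (h.path _ (List.getElem_mem i.2)).2.imp fun a b hab => ?_
    obtain ⟨ha, hb, hab⟩ := hab
    rwa [hf a ha, hf b hb]
  refine ⟨L.length, by omega, _, _, fun i => ⟨SimpleGraph.Walk.ofSupport _ (hne i) (hch i), ?_⟩,
    ?_, ?_⟩
  · rw [SimpleGraph.Walk.isPath_def, SimpleGraph.Walk.support_ofSupport]
    have hi := List.getElem_mem (l := L) i.2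
    exact List.Nodup.map_on (fun a ha b hb => hfinj _ hi _ hi a ha b hb) (hn1 _ hi)
  · have key : ∀ i j : Fin L.length, i < j → List.Disjoint ((L[i]).map f) ((L[j]).map f) := by
      intro i j hij
      have hd := List.pairwise_iff_getElem.1 hn2 i j i.2 j.2 hij
      intro y hy hy'
      obtain ⟨a, ha, rfl⟩ := List.mem_map.1 hy
      obtain ⟨b, hb, e⟩ := List.mem_map.1 hy'
      have := hfinj _ (List.getElem_mem j.2) _ (List.getElem_mem i.2) b hb a ha e
      exact hd ha (this ▸ hb)
    intro i j hij
    simp only [SimpleGraph.Walk.support_ofSupport]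
    rcases lt_or_gt_of_ne hij with h | h
    exacts [key i j h, (key j i h).symm]
  · intro v
    obtain ⟨l, hl, hv⟩ := List.mem_flatten.1 ((hmem v).2 v.2)
    obtain ⟨i, hi, rfl⟩ := List.getElem_of_mem hl
    refine ⟨⟨i, hi⟩, ?_⟩
    simp only [SimpleGraph.Walk.support_ofSupport]
    exact List.mem_map.2 ⟨v, hv, hf v v.2⟩

theorem exists_ordering_of_isYes (h : x.IsYes) : ∃ (e pos : ℕ → ℕ) (E : Finset ℕ),
    IsOrdering x.n e pos ∧ (∀ i ∈ E, Gap (Adjacent x) x.n e i) ∧ x.n ≤ E.card + x.k := by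
  obtain ⟨m, hm, s, t, P, hdisj, hcov⟩ := h
  set L : List (List ℕ) := List.ofFn fun i => (P i).1.support.map Fin.val with hL
  have hLmem : ∀ l, l ∈ L ↔ ∃ i, (P i).1.support.map Fin.val = l := fun l => by
    rw [hL, List.mem_ofFn]
  have hnodup : L.flatten.Nodup := by
    rw [List.nodup_flatten]
    constructor
    · intro l hl
      obtain ⟨i, rfl⟩ := (hLmem l).1 hl
      exact (P i).2.support_nodup.map Fin.val_injective
    · rw [hL, List.pairwise_ofFn]
      intro i j hij y hy hy'
      obtain ⟨a, ha, rfl⟩ := List.mem_map.1 hy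
      obtain ⟨b, hb, e⟩ := List.mem_map.1 hy'
      exact hdisj i j hij.ne ha (Fin.ext e ▸ hb)
  have hmem : ∀ v, v ∈ L.flatten ↔ v < x.n := by
    intro v
    rw [List.mem_flatten]
    constructor
    · rintro ⟨l, hl, hv⟩
      obtain ⟨i, rfl⟩ := (hLmem l).1 hl
      obtain ⟨a, -, rfl⟩ := List.mem_map.1 hv
      exact a.2
    · intro hv
      obtain ⟨i, hi⟩ := hcov ⟨v, hv⟩
      exact ⟨_, (hLmem _).2 ⟨i, rfl⟩, List.mem_map.2 ⟨_, hi, rfl⟩⟩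
  have hlen : L.flatten.length = x.n := by
    rw [← List.toFinset_card_of_nodup hnodup, ← Finset.card_range x.n]
    congr 1
    ext v
    simp only [List.mem_toFinset, Finset.mem_range, hmem]
  have hle := length_flatten_le_gapCount (A := Adjacent x) L (fun l hl => by
    obtain ⟨i, rfl⟩ := (hLmem l).1 hl
    refine ⟨by simp, ?_⟩
    rw [List.isChain_map]
    exact (P i).1.isChain_adj_support.imp fun a b hab => ⟨a.2, b.2, hab⟩)
  obtain ⟨E, hE, hg⟩ := exists_finset_gapCount (A := Adjacent x) L.flatten
  rw [hlen] at hle hg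
  have hLl : L.length = m := by simp [hL]
  refine ⟨fun i => L.flatten.getD i 0, fun v => L.flatten.idxOf v, E, ⟨?_, ?_, ?_, ?_⟩, hg,
    by omega⟩
  · intro v hv
    rw [← hlen]
    exact List.idxOf_lt_length_of_mem ((hmem v).2 hv)
  · intro i hi
    rw [← hlen] at hi
    rw [List.getD_eq_getElem _ _ hi, ← hmem]
    exact List.getElem_mem hi
  · intro v hv
    have := List.idxOf_lt_length_of_mem ((hmem v).2 hv)
    rw [List.getD_eq_getElem _ _ this, List.getElem_idxOf]
  · intro i hi
    rw [← hlen] at hi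
    rw [List.getD_eq_getElem _ _ hi]
    exact hnodup.idxOf_getElem i hi

theorem exists_cover (x : UPPInstance) : ∃ C : Finset ℕ, C.card = x.vc ∧ (∀ i ∈ C, i < x.n) ∧
    ∀ u v, Adjacent x u v → u ∈ C ∨ v ∈ C := by
  classical
  obtain ⟨s, hs, hc⟩ := x.G.vertexCoverNum_exists
  refine ⟨s.toFinset.map Fin.valEmbedding, ?_, ?_, ?_⟩
  · rw [Finset.card_map, UPPInstance.vc, ← hs, Set.encard_eq_coe_toFinset_card]
    rfl
  · intro i hi
    obtain ⟨a, -, rfl⟩ := Finset.mem_map.1 hi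
    exact a.2
  · rintro u v ⟨hu, hv, h⟩
    simp only [Finset.mem_map, Set.mem_toFinset]
    exact (hc h).imp (fun h => ⟨_, h, rfl⟩) (fun h => ⟨_, h, rfl⟩)

theorem vc_le (x : UPPInstance) : x.vc ≤ x.n := by
  obtain ⟨C, hC, hlt, -⟩ := exists_cover x
  rw [← hC, ← Finset.card_range x.n]
  exact Finset.card_le_card fun i hi => Finset.mem_range.2 (hlt i hi)

end UPPAlgorithm

/-! ### Mate functions and instances as numbers -/

namespace UPPAlgorithm

/-- The number with base-`B` digits `m 0, …, m (K - 1)`, lowest digit first. -/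
def code (B K : ℕ) (m : ℕ → ℕ) : ℕ := ∑ i ∈ Finset.range K, m i * B ^ i

theorem code_succ' (B K : ℕ) (m : ℕ → ℕ) :
    code B (K + 1) m = m 0 + B * code B K fun i => m (i + 1) := by
  rw [code, Finset.sum_range_succ', code, Finset.mul_sum]
  simp only [pow_zero, mul_one, pow_succ]
  rw [add_comm]
  congr 1
  exact Finset.sum_congr rfl fun i _ => by ring

theorem code_lt {B K : ℕ} {m : ℕ → ℕ} (hm : ∀ i < K, m i < B) : code B K m < B ^ K := by
  induction K generalizing m with
  | zero => simp [code]
  | succ K ih =>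
    rw [code_succ', pow_succ]
    have h1 := ih fun i hi => hm (i + 1) (by omega)
    have h2 := hm 0 (by omega)
    nlinarith

theorem code_digit {B K i : ℕ} {m : ℕ → ℕ} (hm : ∀ i < K, m i < B) (hi : i < K) :
    code B K m / B ^ i % B = m i := by
  induction K generalizing m i with
  | zero => omega
  | succ K ih =>
    rw [code_succ']
    have h0 := hm 0 (by omega)
    cases i with
    | zero => rw [pow_zero, Nat.div_one, Nat.add_mul_mod_self_left, Nat.mod_eq_of_lt h0]
    | succ i =>
      rw [pow_succ', ← Nat.div_div_eq_div_mul, Nat.add_mul_div_left _ _ (by omega),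
        Nat.div_eq_of_lt h0, zero_add]
      exact ih (fun j hj => hm (j + 1) (by omega)) (by omega)

theorem code_update {B K i : ℕ} (m : ℕ → ℕ) (hi : i < K) (d : ℕ) :
    code B K m + d * B ^ i - m i * B ^ i = code B K (Function.update m i d) := by
  unfold code
  have hmem := Finset.mem_range.2 hi
  rw [← Finset.add_sum_erase _ _ hmem, ← Finset.add_sum_erase _ _ hmem, Function.update_self]
  rw [Finset.sum_congr rfl fun j hj =>
    show Function.update m i d j * B ^ j = m j * B ^ j by
      rw [Function.update_of_ne (Finset.ne_of_mem_erase hj)]]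
  omega

theorem code_inj {B K : ℕ} {m m' : ℕ → ℕ} (hm : ∀ i < K, m i < B) (hm' : ∀ i < K, m' i < B)
    (h : code B K m = code B K m') : ∀ i < K, m i = m' i := fun i hi => by
  rw [← code_digit hm hi, h, code_digit hm' hi]

theorem IsMate.lt {n : ℕ} {m : ℕ → ℕ} (hm : IsMate n m) : ∀ i < n + 2, m i < n + 2 := by
  intro i hi
  by_cases h : i < n
  · have := hm.range i h; omega
  · rw [hm.fixed i (by omega)]; exact hi

/-! ### The input word -/

theorem encode_eq (x : UPPInstance) : ∃ f : Fin (x.n * x.n) → ℕ,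
    x.encode = x.n :: x.k :: List.ofFn f ∧ (∀ t, f t ≤ 1) ∧
      ∀ t, f t ≠ 0 ↔ Adjacent x (t / x.n) (t % x.n) := by
  classical
  have hmod : ∀ t : Fin (x.n * x.n), t.1 / x.n < x.n ∧ t.1 % x.n < x.n := fun t =>
    have hpos : 0 < x.n := Nat.pos_of_ne_zero fun h => by have := t.2; simp [h] at this
    ⟨(Nat.div_lt_iff_lt_mul hpos).2 t.2, Nat.mod_lt _ hpos⟩
  refine ⟨fun t => if x.G.Adj ⟨t / x.n, (hmod t).1⟩ ⟨t % x.n, (hmod t).2⟩ then 1 else 0,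
    ?_, ?_, ?_⟩
  · rw [UPPInstance.encode, List.ofFn_mul, List.flatMap_def]
    congr 3
    rw [List.ofFn_eq_map]
    refine List.map_congr_left fun i _ => ?_
    rw [List.ofFn_eq_map]
    refine List.map_congr_left fun j _ => ?_
    have hj := j.2
    have h1 : (i * x.n + j) / x.n = i := Nat.div_eq_of_lt_le (by omega) (by nlinarith)
    have h2 : (i * x.n + j) % x.n = j := by
      rw [mul_comm, Nat.mul_add_mod, Nat.mod_eq_of_lt hj]
    simp only [h1, h2]
  · intro t; dsimp only; split_ifs <;> simp
  · intro t
    have := hmod t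
    simp [Adjacent, this.1, this.2]

theorem encode_length (x : UPPInstance) : x.encode.length = x.n * x.n + 2 := by
  obtain ⟨f, hf, -⟩ := encode_eq x
  simp [hf]

theorem encode_adj (x : UPPInstance) {t : ℕ} (ht : t < x.n * x.n) :
    x.encode.getD (2 + t) 0 ≠ 0 ↔ Adjacent x (t / x.n) (t % x.n) := by
  obtain ⟨f, hf, -, h⟩ := encode_eq x
  rw [hf, ← h ⟨t, ht⟩, show 2 + t = t + 1 + 1 by omega, List.getD_cons_succ, List.getD_cons_succ,
    List.getD_eq_getElem _ _ (by simpa using ht), List.getElem_ofFn]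

theorem length_le_inputSize (w : List ℕ) : w.length ≤ RAM.inputSize w := by
  unfold RAM.inputSize
  induction w with
  | nil => simp
  | cons a w ih => simp only [List.map_cons, List.sum_cons, List.length_cons]; omega

theorem getD_lt_two_pow (w : List ℕ) (i : ℕ) : w.getD i 0 < 2 ^ RAM.inputSize w := by
  by_cases h : i < w.length
  · rw [List.getD_eq_getElem _ _ h, ← Nat.size_le]
    have := List.single_le_sum (l := w.map fun c => Nat.size c + 1) (fun _ _ => Nat.zero_le _)
      (Nat.size w[i] + 1) (List.mem_map.2 ⟨w[i], List.getElem_mem h, rfl⟩)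
    unfold RAM.inputSize
    omega
  · rw [List.getD_eq_default _ _ (by omega)]
    positivity

theorem bounded_init (w : List ℕ) {L : ℕ} (hL : RAM.inputSize w ≤ L) :
    RAM.Bounded L (RAM.init w) := by
  have hp : 2 ^ RAM.inputSize w ≤ 2 ^ L := Nat.pow_le_pow_right (by norm_num) hL
  constructor
  · intro r
    simp only [RAM.init]
    split_ifs
    · exact (Nat.lt_two_pow_self.trans_le (Nat.pow_le_pow_right (by norm_num)
        (length_le_inputSize w))).trans_le hp
    · positivity
  · intro a i
    simp only [RAM.init]
    split_ifs
    · exact (getD_lt_two_pow w i).trans_le hp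
    · positivity

theorem n_mul_n_le_inputSize (x : UPPInstance) :
    x.n * x.n + 2 ≤ RAM.inputSize x.encode :=
  (encode_length x).symm.le.trans (length_le_inputSize _)

end UPPAlgorithm

/-! ### The program for a minimum vertex cover -/

namespace UPPAlgorithm

open RAM

/-- Nonzero exactly if `a` and `b` have different values. -/
def neE (a b : Expr) : Expr := (a - b) + (b - a)

/-- The remainder of `a` modulo `b`. -/
def modE (a b : Expr) : Expr := a - a / b * b

/-- The number of vertices. -/
def nE : Expr := .read 0 (.lit 0)

@[simp] theorem neE_eval_eq_zero (a b : Expr) (σ : State) :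
    (neE a b).eval σ = 0 ↔ a.eval σ = b.eval σ := by
  simp only [neE, Expr.eval_add, Expr.eval_sub]; omega

@[simp] theorem modE_eval (a b : Expr) (σ : State) :
    (modE a b).eval σ = a.eval σ % b.eval σ := by
  simp only [modE, Expr.eval_sub, Expr.eval_mul, Expr.eval_div]
  have := Nat.div_add_mod' (a.eval σ) (b.eval σ)
  omega

@[simp] theorem nE_eval (σ : State) : nE.eval σ = σ.mem 0 0 := rfl

/-- One step of the greedy scan. Register `1` holds the initial decision word `W` of the round,
register `2` the success flag, register `3` the decisions left, register `4` the time; a vertex `i`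
is in the cover if cell `i` of array `1` is `W`. -/
def scanBody : Prog :=
  .seq
    (.ifNonzero (.read 0 (.lit 2 + .reg 4) * neE (.read 1 (.reg 4 / nE)) (.reg 1) *
        neE (.read 1 (modE (.reg 4) nE)) (.reg 1))
      (.ifNonzero (.reg 3 - .lit 1)
        (.seq
          (.ifNonzero (modE (.reg 3) (.lit 2))
            (.store 1 (.reg 4 / nE) (.reg 1))
            (.store 1 (modE (.reg 4) nE) (.reg 1)))
          (.assign 3 (.reg 3 / .lit 2)))
        (.assign 2 (.lit 0)))
      .skip)
    (.assign 4 (.reg 4 + .lit 1))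

/-- The scan of all pairs. -/
def scanProg : Prog := .whileNonzero (nE * nE - .reg 4) scanBody

/-- A round prepares the scan, performs it, and passes on to the next decision word if the scan
failed. -/
def roundPrep : Prog := .seq (.assign 3 (.reg 1)) (.seq (.assign 2 (.lit 1)) (.assign 4 (.lit 0)))

def roundProg : Prog := .seq roundPrep (.seq scanProg (.assign 1 (.reg 1 + (.lit 1 - .reg 2))))

/-- Rounds are repeated until one succeeds. -/
def coverProg : Prog := .seq (.assign 1 (.lit 1)) (.whileNonzero (.lit 1 - .reg 2) roundProg)

/-- The input is intact and the arrays from `2` on are empty. -/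
structure Clean (x : UPPInstance) (σ : State) : Prop where
  input : ∀ i, σ.mem 0 i = x.encode.getD i 0
  empty : ∀ a, 2 ≤ a → ∀ i, σ.mem a i = 0

/-- Array `1` holds `W` exactly at the members of `X`, and smaller numbers elsewhere. -/
structure Marks (W : ℕ) (X : Finset ℕ) (σ : State) : Prop where
  reg : σ.reg 1 = W
  iff : ∀ i, σ.mem 1 i = W ↔ i ∈ X
  le : ∀ i, σ.mem 1 i ≤ W

theorem encode_n (x : UPPInstance) : x.encode.getD 0 0 = x.n := rfl
theorem encode_k (x : UPPInstance) : x.encode.getD 1 0 = x.k := rfl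

/-- Invariant of the scan: what is left of it leads to the outcome `fin`. -/
structure ScanInv (x : UPPInstance) (W : ℕ) (fin : Branch) (σ : State) : Prop where
  clean : Clean x σ
  time : σ.reg 4 ≤ x.n * x.n
  branch : ∃ g : Branch, Marks W g.X σ ∧ σ.reg 2 = g.ok ∧ σ.reg 3 = g.w ∧
    g.run (Adjacent x) x.n (x.n * x.n - σ.reg 4) (σ.reg 4) = fin

theorem scanBody_wp {x : UPPInstance} {W L : ℕ} {fin : Branch} {σ : State}
    (hL : x.n * x.n < 2 ^ L) (hb : Bounded L σ) (h : ScanInv x W fin σ)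
    (hlt : σ.reg 4 < x.n * x.n) :
    scanBody.wp L (fun σ' => ScanInv x W fin σ' ∧
      x.n * x.n - σ'.reg 4 < x.n * x.n - σ.reg 4) σ := by
  obtain ⟨⟨hin, hemp⟩, -, g, ⟨hW, hX, hle⟩, hok, hw, hrun⟩ := h
  have hn : σ.mem 0 0 = x.n := hin 0
  have hA : σ.mem 0 (2 + σ.reg 4) = 0 ↔ ¬ Adjacent x (σ.reg 4 / x.n) (σ.reg 4 % x.n) := by
    rw [hin, ← encode_adj x hlt, not_not]
  obtain ⟨f, hf⟩ : ∃ f, x.n * x.n - σ.reg 4 = f + 1 := ⟨x.n * x.n - σ.reg 4 - 1, by omega⟩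
  have hf' : x.n * x.n - (σ.reg 4 + 1) = f := by omega
  rw [hf, Branch.run] at hrun
  have hWL : W < 2 ^ L := hW ▸ hb.reg 1
  have hwL : σ.reg 3 / 2 < 2 ^ L := (Nat.div_le_self _ _).trans_lt (hb.reg 3)
  have htL : σ.reg 4 + 1 < 2 ^ L := by omega
  have done : ∀ (g' : Branch) (σ' : State), (∀ i, σ'.mem 0 i = σ.mem 0 i) →
      (∀ a, 2 ≤ a → ∀ i, σ'.mem a i = σ.mem a i) → σ'.reg 4 = σ.reg 4 + 1 → Marks W g'.X σ' →
      σ'.reg 2 = g'.ok → σ'.reg 3 = g'.w →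
      Branch.run (Adjacent x) x.n f (σ.reg 4 + 1) g' = fin →
      ScanInv x W fin σ' ∧ x.n * x.n - σ'.reg 4 < x.n * x.n - σ.reg 4 := by
    intro g' σ' h1 h2 h3 h4 h5 h6 h7
    refine ⟨⟨⟨fun i => (h1 i).trans (hin i), fun a ha i => (h2 a ha i).trans (hemp a ha i)⟩,
      by omega, g', h4, h5, h6, ?_⟩, by omega⟩
    rw [h3, hf', h7]
  have mark : ∀ y v τ, Marks W (insert y g.X)
      (((σ.setMem 1 y W).setReg 3 v).setReg 4 τ) := by
    refine fun y v τ => ⟨by simp [hW], fun i => ?_, fun i => ?_⟩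
    · simp only [State.setReg_mem, State.setMem_mem, Finset.mem_insert, true_and]
      split_ifs with h
      · simp [h]
      · simp [h, hX]
    · simp only [State.setReg_mem, State.setMem_mem]
      split_ifs
      exacts [le_rfl, hle i]
  unfold Branch.step at hrun
  simp only [scanBody, Prog.wp, Expr.eval_mul, Expr.eval_add, Expr.eval_sub, Expr.eval_div,
    Expr.eval_reg, Expr.eval_read, Expr.eval_lit, nE_eval, modE_eval, neE_eval_eq_zero,
    mul_eq_zero, ne_eq, hA, hn, hW, hX, hw]
  constructor
  · intro h1
    have h1 : Adjacent x (σ.reg 4 / x.n) (σ.reg 4 % x.n) ∧ σ.reg 4 / x.n ∉ g.X ∧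
        σ.reg 4 % x.n ∉ g.X := by tauto
    rw [if_pos h1] at hrun
    constructor
    · intro h2
      rw [if_pos (by omega)] at hrun
      constructor
      · intro h3
        rw [if_pos (by omega)] at hrun
        exact ⟨hWL, hwL, htL, done _ _ (by simp) (fun a ha => by simp [show a ≠ 1 by omega])
          (by simp) (mark _ _ _) (by simpa using hok) (by simp [hw]) hrun⟩
      · intro h3
        rw [if_neg (by omega)] at hrun
        exact ⟨hWL, hwL, htL, done _ _ (by simp) (fun a ha => by simp [show a ≠ 1 by omega])
          (by simp) (mark _ _ _) (by simpa using hok) (by simp [hw]) hrun⟩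
    · intro h2
      rw [if_neg (by omega)] at hrun
      exact ⟨by positivity, htL, done _ _ (by simp) (by simp) (by simp)
        ⟨by simp [hW], by simpa using hX, by simpa using hle⟩ (by simp) (by simp [hw]) hrun⟩
  · intro h1
    have h1 : ¬ (Adjacent x (σ.reg 4 / x.n) (σ.reg 4 % x.n) ∧ σ.reg 4 / x.n ∉ g.X ∧
        σ.reg 4 % x.n ∉ g.X) := by tauto
    rw [if_neg h1] at hrun
    exact ⟨htL, done _ _ (by simp) (by simp) (by simp)
      ⟨by simp [hW], by simpa using hX, by simpa using hle⟩ (by simpa using hok)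
      (by simp [hw]) hrun⟩

/-- Invariant of the rounds: the decision words before `W` have failed, and once the flag is set,
array `1` marks a vertex cover of at most `vc` vertices. -/
structure CoverInv (x : UPPInstance) (σ : State) : Prop where
  clean : Clean x σ
  one_le : 1 ≤ σ.reg 1
  lt : σ.reg 1 < 2 ^ (x.vc + 1)
  fresh : σ.reg 2 = 0 → (∀ i, σ.mem 1 i < σ.reg 1) ∧ ∀ w, 1 ≤ w → w < σ.reg 1 →
    (Branch.run (Adjacent x) x.n (x.n * x.n) 0 ⟨∅, w, 1⟩).ok = 0
  found : σ.reg 2 ≠ 0 → ∃ S : Finset ℕ, Marks (σ.reg 1) S σ ∧ S.card ≤ x.vc ∧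
    (∀ i ∈ S, i < x.n) ∧ ∀ u v, Adjacent x u v → u ∈ S ∨ v ∈ S

/-- Running time of a round. -/
def roundWeight (n : ℕ) : ℕ :=
  roundPrep.weight + ((n * n + 1) * ((nE * nE - .reg 4).weight + 1 + scanBody.weight) +
    (Prog.assign 1 (.reg 1 + (.lit 1 - .reg 2))).weight)

theorem roundProg_runs {x : UPPInstance} {L : ℕ} {σ : State}
    (hL : x.n * x.n < 2 ^ L) (hL' : 2 ^ (x.vc + 1) ≤ 2 ^ L) (hb : Bounded L σ)
    (h : CoverInv x σ) (h0 : σ.reg 2 = 0) :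
    Runs L roundProg σ (roundWeight x.n) fun σ' => CoverInv x σ' ∧
      (if σ'.reg 2 = 0 then 2 ^ (x.vc + 1) - σ'.reg 1 else 0) <
        (if σ.reg 2 = 0 then 2 ^ (x.vc + 1) - σ.reg 1 else 0) := by
  obtain ⟨hclean, hone, hlt, hfresh, -⟩ := h
  obtain ⟨hmarks, hfail⟩ := hfresh h0
  obtain ⟨W, hW⟩ : ∃ W, W = σ.reg 1 := ⟨_, rfl⟩
  rw [← hW] at hone hlt hmarks hfail
  set fin := Branch.run (Adjacent x) x.n (x.n * x.n) 0 ⟨∅, W, 1⟩ with hfin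
  have hprep : Runs L roundPrep σ roundPrep.weight
      fun σ' => ScanInv x W fin σ' ∧ σ'.reg 4 = 0 := by
    refine Runs.of_wp hb ?_
    simp only [roundPrep, Prog.wp, Expr.eval_reg, Expr.eval_lit]
    refine ⟨hb.reg 1, Nat.one_lt_two_pow ?_, by positivity, ⟨⟨?_, ?_⟩, ?_, ?_⟩, by simp⟩
    · rintro rfl
      have := Nat.one_lt_two_pow (show x.vc + 1 ≠ 0 by omega)
      omega
    · simpa using hclean.input
    · simpa using hclean.empty
    · simp
    · refine ⟨⟨∅, W, 1⟩, ⟨by simp [hW], ?_, ?_⟩, by simp, by simp [hW], by simp [hfin]⟩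
      · intro i
        have := (hmarks i).ne
        simpa using this
      · intro i
        simpa using (hmarks i).le
  refine (hprep.seq fun σ₁ hb₁ ⟨h₁, ht₁⟩ => ?_ : Runs L _ _ (_ + _) _)
  have hscan := Runs.while (L := L) (e := nE * nE - .reg 4) (p := scanBody) (w := scanBody.weight)
    (ScanInv x W fin) (fun σ => x.n * x.n - σ.reg 4) (fun τ hbτ hτ he => by
      refine Runs.of_wp hbτ (scanBody_wp hL hbτ hτ ?_)
      have := hτ.clean.input 0
      rw [encode_n] at this
      simp only [Expr.eval_sub, Expr.eval_mul, nE_eval, Expr.eval_reg, this] at he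
      omega) hb₁ h₁
  simp only [ht₁, Nat.sub_zero] at hscan
  refine hscan.seq fun σ₂ hb₂ ⟨h₂, ht₂⟩ => Runs.of_wp hb₂ ?_
  obtain ⟨hc₂, hle₂, g, hm₂, hok, -, hrun⟩ := h₂
  have hn₂ := hc₂.input 0
  rw [encode_n] at hn₂
  simp only [Expr.eval_sub, Expr.eval_mul, nE_eval, Expr.eval_reg, hn₂] at ht₂
  rw [ht₂, Branch.run] at hrun
  subst hrun
  simp only [Prog.wp, Expr.eval_add, Expr.eval_sub, Expr.eval_reg, Expr.eval_lit, hm₂.reg, hok]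
  obtain ⟨C, hC, -, hCcov⟩ := exists_cover x
  by_cases hg : fin.ok = 0
  · -- some decision word below `2 ^ (vc + 1)` succeeds, and it comes after `W`
    obtain ⟨w, hw1, hw2, hw3⟩ :=
      Branch.exists_run_ok (n := x.n) hCcov (x.n * x.n) 0 ∅
    rw [Finset.sdiff_empty, hC] at hw2
    have hWw : W + 1 ≤ w := by
      by_contra hh
      rcases Nat.lt_or_ge w W with h | h
      · exact hw3 (hfail w hw1 h)
      · obtain rfl : w = W := by omega
        exact hw3 hg
    refine ⟨by omega, ⟨⟨by simpa using hc₂.input, by simpa using hc₂.empty⟩, ?_,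
      ?_, ?_, ?_⟩, ?_⟩
    · simp only [State.setReg_reg, if_true]; omega
    · simp only [State.setReg_reg, if_true]; omega
    · intro _
      simp only [State.setReg_reg, if_true, hg, State.setReg_mem]
      refine ⟨fun i => by have := hm₂.le i; omega, fun w' h1 h2 => ?_⟩
      rcases Nat.lt_or_ge w' W with h | h
      · exact hfail w' h1 h
      · obtain rfl : w' = W := by omega
        exact hg
    · intro hne
      simp [hok, hg] at hne
    · simp only [State.setReg_reg, if_true, hok, hg, h0, ← hW]
      simp only [show (2 : ℕ) ≠ 1 by norm_num, if_false, if_true]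
      omega
  · obtain ⟨-, -, hcov⟩ := Branch.run_sound _ _ _ hg
    obtain ⟨hcard, hsub⟩ := Branch.run_card (n := x.n)
      (fun u v h => ⟨(Adjacent.lt_lt_ne u v h).1, (Adjacent.lt_lt_ne u v h).2.1⟩) (x.n * x.n) 0
      ⟨∅, W, 1⟩ hone (by simp)
    simp only [Finset.card_empty, pow_zero, one_mul] at hcard
    have h1g : 1 - fin.ok = 0 := by omega
    have hm₃ : Marks W fin.X (σ₂.setReg 1 W) := ⟨by simp, by simpa using hm₂.iff,
      by simpa using hm₂.le⟩
    simp only [h1g, add_zero]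
    refine ⟨by omega, ⟨⟨by simpa using hc₂.input, by simpa using hc₂.empty⟩, by simpa using hone,
      by simpa using hlt, ?_, ?_⟩, ?_⟩
    · intro hne
      simp [hok, hg] at hne
    · intro _
      refine ⟨fin.X, by simpa using hm₃, ?_, fun i hi => Finset.mem_range.1 (hsub hi), ?_⟩
      · exact Nat.lt_succ_iff.1
          ((Nat.pow_lt_pow_iff_right (show 1 < 2 by norm_num)).1 (hcard.trans_lt hlt))
      · rintro u v huv
        obtain ⟨hu, hv, -⟩ := Adjacent.lt_lt_ne u v huv
        have e1 : (u * x.n + v) / x.n = u := Nat.div_eq_of_lt_le (by omega) (by nlinarith)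
        have e2 : (u * x.n + v) % x.n = v := by
          rw [mul_comm, Nat.mul_add_mod, Nat.mod_eq_of_lt hv]
        have := hcov (u * x.n + v) (Nat.zero_le _) (by nlinarith)
        rw [e1, e2] at this
        exact this huv
    · rw [if_neg (by simpa [hok] using hg), if_pos h0, ← hW]
      omega

/-- Running time of the search for a minimum vertex cover. -/
def coverWeight (n vc : ℕ) : ℕ :=
  (Prog.assign 1 (.lit 1)).weight +
    2 ^ (vc + 1) * ((Expr.lit 1 - .reg 2).weight + 1 + roundWeight n)

theorem coverProg_runs {x : UPPInstance} {L : ℕ}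
    (hL : x.n * x.n < 2 ^ L) (hL' : 2 ^ (x.vc + 1) ≤ 2 ^ L)
    (hb : Bounded L (init x.encode)) :
    Runs L coverProg (init x.encode) (coverWeight x.n x.vc) fun σ => Clean x σ ∧
      ∃ (W : ℕ) (S : Finset ℕ), Marks W S σ ∧ S.card ≤ x.vc ∧ (∀ i ∈ S, i < x.n) ∧
        ∀ u v, Adjacent x u v → u ∈ S ∨ v ∈ S := by
  have hpow := Nat.one_lt_two_pow (show x.vc + 1 ≠ 0 by omega)
  have hinit : Runs L (.assign 1 (.lit 1)) (init x.encode) (Prog.assign 1 (.lit 1)).weight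
      fun σ => CoverInv x σ ∧ σ.reg 1 = 1 ∧ σ.reg 2 = 0 := by
    refine Runs.of_wp hb ?_
    simp only [Prog.wp, Expr.eval_lit]
    refine ⟨by omega, ⟨⟨fun i => by simp [init], fun a ha i => by simp [init, show a ≠ 0 by omega]⟩,
      by simp, by simp, fun _ => ⟨by simp [init], fun w h1 h2 => ?_⟩, ?_⟩, by simp,
      by simp [init]⟩
    · simp only [State.setReg_reg, if_true] at h2; omega
    · simp [init]
  refine hinit.seq fun σ hbσ ⟨hσ, h1, h2⟩ => ?_
  have hloop := Runs.while (L := L) (e := .lit 1 - .reg 2) (p := roundProg)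
    (w := roundWeight x.n) (CoverInv x)
    (fun σ => if σ.reg 2 = 0 then 2 ^ (x.vc + 1) - σ.reg 1 else 0)
    (fun τ hbτ hτ he => roundProg_runs hL hL' hbτ hτ (by
      simp only [Expr.eval_sub, Expr.eval_lit, Expr.eval_reg] at he; omega)) hbσ hσ
  refine hloop.mono ?_ fun σ' _ ⟨h3, h4⟩ => ?_
  · simp only [h1, h2, if_true]
    rw [Nat.sub_add_cancel hpow.le]
  · simp only [Expr.eval_sub, Expr.eval_lit, Expr.eval_reg] at h4
    obtain ⟨S, hS⟩ := h3.found (by omega)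
    exact ⟨h3.clean, _, S, hS⟩

end UPPAlgorithm

/-! ### The program for the dynamic program -/

namespace UPPAlgorithm

open RAM

/-- The base of the digits: mates are vertices, the ghost value or the closed value. -/
def baseE : Expr := nE + .lit 2

/-- The value for vertices that admit no further edge. -/
def closedE : Expr := nE + .lit 1

/-- Digit `i` of register `6`, by means of the table of powers in array `2`. -/
def digitE (i : Expr) : Expr := modE (.reg 6 / .read 2 i) baseE

/-- Register `6` with digit `i` replaced by `d`. -/
def setDigitE (i d : Expr) : Expr := .reg 6 + d * .read 2 i - digitE i * .read 2 i

/-- The input, the marks of a vertex cover `S` in array `1`, and the powers of the base in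
array `2`. -/
structure Tables (x : UPPInstance) (W : ℕ) (S : Finset ℕ) (σ : State) : Prop where
  input : ∀ i, σ.mem 0 i = x.encode.getD i 0
  marks : Marks W S σ
  pow : ∀ i ≤ x.n + 2, σ.mem 2 i = (x.n + 2) ^ i

variable {x : UPPInstance} {W L M : ℕ} {S : Finset ℕ}

theorem Tables.congr {σ σ' : State} (h : Tables x W S σ) (hr : σ'.reg 1 = σ.reg 1)
    (hm : ∀ a, a < 3 → σ'.mem a = σ.mem a) : Tables x W S σ' where
  input := by rw [hm 0 (by norm_num)]; exact h.input
  marks := ⟨hr.trans h.marks.reg, by rw [hm 1 (by norm_num)]; exact h.marks.iff,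
    by rw [hm 1 (by norm_num)]; exact h.marks.le⟩
  pow := by rw [hm 2 (by norm_num)]; exact h.pow

theorem Tables.n_eq {σ : State} (h : Tables x W S σ) : σ.mem 0 0 = x.n := h.input 0

/-- Register `6` holds the code of the function `m`. -/
structure Holds (x : UPPInstance) (W : ℕ) (S : Finset ℕ) (m : ℕ → ℕ) (σ : State) : Prop where
  tables : Tables x W S σ
  reg : σ.reg 6 = code (x.n + 2) (x.n + 2) m
  lt : ∀ i < x.n + 2, m i < x.n + 2

theorem Holds.digitE_eval {m : ℕ → ℕ} {σ : State} (h : Holds x W S m σ) {i : Expr}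
    (hi : i.eval σ < x.n + 2) : (digitE i).eval σ = m (i.eval σ) := by
  simp only [digitE, modE_eval, Expr.eval_div, Expr.eval_reg, Expr.eval_read, baseE,
    Expr.eval_add, nE_eval, Expr.eval_lit, h.tables.n_eq, h.tables.pow _ hi.le, h.reg]
  exact code_digit h.lt hi

theorem Holds.setDigit_wp {m : ℕ → ℕ} {σ : State} (h : Holds x W S m σ)
    (hL : (x.n + 2) ^ (x.n + 2) < 2 ^ L) {i d : Expr} {i₀ d₀ : ℕ} (hi : i.eval σ = i₀)
    (hd : d.eval σ = d₀) (hi₀ : i₀ < x.n + 2) (hd₀ : d₀ < x.n + 2) {Q : State → Prop}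
    (hQ : ∀ σ', Holds x W S (Function.update m i₀ d₀) σ' → σ'.mem = σ.mem →
      (∀ r, r ≠ 6 → σ'.reg r = σ.reg r) → Q σ') :
    (Prog.assign 6 (setDigitE i d)).wp L Q σ := by
  have hval : (setDigitE i d).eval σ = code (x.n + 2) (x.n + 2) (Function.update m i₀ d₀) := by
    rw [← code_update m hi₀ d₀]
    simp only [setDigitE, Expr.eval_sub, Expr.eval_add, Expr.eval_mul, Expr.eval_reg,
      Expr.eval_read, h.digitE_eval (hi ▸ hi₀), hi, hd, h.tables.pow _ hi₀.le, h.reg]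
  have hlt : ∀ i < x.n + 2, Function.update m i₀ d₀ i < x.n + 2 := by
    intro j hj
    rw [Function.update_apply]
    split_ifs
    exacts [hd₀, h.lt j hj]
  refine ⟨?_, hQ _ ⟨h.tables.congr (by simp) (by simp), by simpa using hval, hlt⟩ rfl
    fun r hr => by simp [hr]⟩
  rw [hval]
  exact (code_lt hlt).trans hL

/-- Adds the edge between the vertices in registers `9` and `10`, whose mates are in registers `13`
and `14`. -/
def joinProg : Prog :=
  .seq (.assign 6 (setDigitE (.reg 9) closedE))
    (.seq (.assign 6 (setDigitE (.reg 10) closedE))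
      (.seq (.assign 6 (setDigitE (.reg 13) (.reg 14)))
        (.seq (.assign 6 (setDigitE (.reg 14) (.reg 13)))
          (.seq (.assign 6 (setDigitE nE nE)) (.assign 7 (.reg 7 + .lit 1))))))

/-- Forgets the vertex in register `9`, whose mate is in register `13`. -/
def forgetProg : Prog :=
  .seq (.assign 6 (setDigitE (.reg 13) nE))
    (.seq (.assign 6 (setDigitE (.reg 9) closedE))
      (.seq (.assign 6 (setDigitE nE nE)) (.assign 6 (setDigitE closedE closedE))))

/-- The condition for adding the edge between the vertices in registers `9` and `10`; the
bit of choice is the parity of register `11`. -/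
def joinCond : Expr :=
  modE (.reg 11) (.lit 2) * .read 0 (.lit 2 + (.reg 9 * nE + .reg 10)) *
    (.lit 1 - neE (.read 1 (.reg 10)) (.reg 1)) * neE (.reg 13) closedE *
    neE (.reg 14) closedE * neE (.reg 13) (.reg 10)

/-- One step of the dynamic program for the state in registers `6` (mate function), `7` (number of
edges) and `8` (time). -/
def stepProg : Prog :=
  .seq (.assign 9 (.reg 8 / (nE + .lit 1)))
    (.seq (.assign 10 (modE (.reg 8) (nE + .lit 1)))
      (.seq (.assign 13 (digitE (.reg 9)))
        (.seq
          (.ifNonzero (nE - .reg 10)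
            (.seq (.assign 14 (digitE (.reg 10))) (.ifNonzero joinCond joinProg .skip))
            (.ifNonzero (neE (.read 1 (.reg 9)) (.reg 1)) forgetProg .skip))
          (.assign 8 (.reg 8 + .lit 1)))))

/-- The registers of a state of the dynamic program. -/
structure Loaded (x : UPPInstance) (W : ℕ) (S : Finset ℕ) (q : MateState) (σ : State) : Prop where
  holds : Holds x W S q.m σ
  edges : σ.reg 7 = q.c
  time : σ.reg 8 = q.t

theorem assign_wp {σ : State} {r : ℕ} {e : Expr} {v : ℕ} {Q : State → Prop}
    (he : e.eval σ = v) (hv : v < 2 ^ L)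
    (hQ : ∀ σ' : State, σ'.mem = σ.mem → σ'.reg r = v → (∀ r', r' ≠ r → σ'.reg r' = σ.reg r') →
      Q σ') : (Prog.assign r e).wp L Q σ := by
  subst he
  exact ⟨hv, hQ _ rfl (by simp) fun r' h => by simp [h]⟩

theorem Holds.congr {m : ℕ → ℕ} {σ σ' : State} (h : Holds x W S m σ) (hm : σ'.mem = σ.mem)
    (h1 : σ'.reg 1 = σ.reg 1) (h6 : σ'.reg 6 = σ.reg 6) : Holds x W S m σ' :=
  ⟨h.tables.congr h1 fun a _ => by rw [hm], h6.trans h.reg, h.lt⟩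

theorem closedE_eval {σ : State} (h : Tables x W S σ) : closedE.eval σ = x.n + 1 := by
  simp only [closedE, Expr.eval_add, nE_eval, Expr.eval_lit, h.n_eq]

theorem joinProg_wp {m : ℕ → ℕ} {σ : State} (h : Holds x W S m σ) {u v : ℕ} (hu : u < x.n)
    (hv : v < x.n) (h9 : σ.reg 9 = u) (h10 : σ.reg 10 = v) (h13 : σ.reg 13 = m u)
    (h14 : σ.reg 14 = m v) (hL : (x.n + 2) ^ (x.n + 2) < 2 ^ L) (hc : σ.reg 7 + 1 < 2 ^ L)
    {Q : State → Prop}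
    (hQ : ∀ σ', Holds x W S (joinMate x.n m u v) σ' → σ'.reg 7 = σ.reg 7 + 1 →
      σ'.mem = σ.mem → (∀ r, r ≠ 6 → r ≠ 7 → σ'.reg r = σ.reg r) → Q σ') :
    joinProg.wp L Q σ := by
  have hmu := h.lt u (by omega)
  have hmv := h.lt v (by omega)
  refine h.setDigit_wp (i := .reg 9) (d := closedE) hL
    h9 (closedE_eval h.tables) (by omega) (by omega)
    fun σ₁ h₁ m₁ r₁ => ?_
  refine h₁.setDigit_wp (i := .reg 10) (d := closedE) hL
    ((r₁ 10 (by norm_num)).trans h10) (closedE_eval h₁.tables) (by omega)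
    (by omega) fun σ₂ h₂ m₂ r₂ => ?_
  have e13 : σ₂.reg 13 = m u := by
    rw [r₂ 13 (by norm_num), r₁ 13 (by norm_num), h13]
  have e14 : σ₂.reg 14 = m v := by
    rw [r₂ 14 (by norm_num), r₁ 14 (by norm_num), h14]
  refine h₂.setDigit_wp (i := .reg 13) (d := .reg 14) hL e13 e14 hmu hmv fun σ₃ h₃ m₃ r₃ => ?_
  refine h₃.setDigit_wp (i := .reg 14) (d := .reg 13) hL
    ((r₃ 14 (by norm_num)).trans e14) ((r₃ 13 (by norm_num)).trans e13)
    hmv hmu fun σ₄ h₄ m₄ r₄ => ?_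
  refine h₄.setDigit_wp (i := nE) (d := nE) hL h₄.tables.n_eq h₄.tables.n_eq (by omega) (by omega)
    fun σ₅ h₅ m₅ r₅ => ?_
  have e : ∀ r, r ≠ 6 → σ₅.reg r = σ.reg r := fun r hr => by
    rw [r₅ r hr, r₄ r hr, r₃ r hr, r₂ r hr, r₁ r hr]
  refine assign_wp (by simp only [Expr.eval_add, Expr.eval_reg, Expr.eval_lit, e 7 (by norm_num)])
    hc fun σ₆ m₆ v₆ r₆ => ?_
  exact hQ σ₆ (h₅.congr m₆ (r₆ 1 (by norm_num)) (r₆ 6 (by norm_num))) v₆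
    (by rw [m₆, m₅, m₄, m₃, m₂, m₁]) fun r hr hr' => (r₆ r hr').trans (e r hr)

theorem forgetProg_wp {m : ℕ → ℕ} {σ : State} (h : Holds x W S m σ) {v : ℕ} (hv : v < x.n)
    (h9 : σ.reg 9 = v) (h13 : σ.reg 13 = m v) (hL : (x.n + 2) ^ (x.n + 2) < 2 ^ L)
    {Q : State → Prop}
    (hQ : ∀ σ', Holds x W S (forgetMate x.n m v) σ' →
      σ'.mem = σ.mem → (∀ r, r ≠ 6 → σ'.reg r = σ.reg r) → Q σ') :
    forgetProg.wp L Q σ := by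
  have hmv := h.lt v (by omega)
  refine h.setDigit_wp (i := .reg 13) (d := nE) hL
    h13 h.tables.n_eq hmv (by omega) fun σ₁ h₁ m₁ r₁ => ?_
  refine h₁.setDigit_wp (i := .reg 9) (d := closedE) hL
    ((r₁ 9 (by norm_num)).trans h9) (closedE_eval h₁.tables) (by omega)
    (by omega) fun σ₂ h₂ m₂ r₂ => ?_
  refine h₂.setDigit_wp (i := nE) (d := nE) hL h₂.tables.n_eq h₂.tables.n_eq (by omega) (by omega)
    fun σ₃ h₃ m₃ r₃ => ?_
  refine h₃.setDigit_wp (i := closedE) (d := closedE) hL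
    (closedE_eval h₃.tables) (closedE_eval h₃.tables) (by omega)
    (by omega) fun σ₄ h₄ m₄ r₄ => ?_
  exact hQ σ₄ h₄ (by rw [m₄, m₃, m₂, m₁]) fun r hr => by rw [r₄ r hr, r₃ r hr, r₂ r hr, r₁ r hr]

theorem joinCond_eval {m : ℕ → ℕ} {σ : State} (h : Holds x W S m σ) {u v : ℕ} (hu : u < x.n)
    (hv : v < x.n) (h9 : σ.reg 9 = u) (h10 : σ.reg 10 = v) (h13 : σ.reg 13 = m u)
    (h14 : σ.reg 14 = m v) : joinCond.eval σ ≠ 0 ↔ σ.reg 11 % 2 ≠ 0 ∧ Adjacent x u v ∧ v ∈ S ∧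
      m u ≠ x.n + 1 ∧ m v ≠ x.n + 1 ∧ m u ≠ v := by
  have hadj : σ.mem 0 (2 + (u * x.n + v)) ≠ 0 ↔ Adjacent x u v := by
    rw [h.tables.input, encode_adj x (by nlinarith),
      show (u * x.n + v) / x.n = u from Nat.div_eq_of_lt_le (by omega) (by nlinarith),
      show (u * x.n + v) % x.n = v by rw [mul_comm, Nat.mul_add_mod, Nat.mod_eq_of_lt hv]]
  have hmem : 1 - (neE (.read 1 (.reg 10)) (.reg 1)).eval σ ≠ 0 ↔ v ∈ S := by
    rw [← h.tables.marks.iff, ← h.tables.marks.reg, ← h10,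
      show 1 - (neE (.read 1 (.reg 10)) (.reg 1)).eval σ ≠ 0 ↔
        (neE (.read 1 (.reg 10)) (.reg 1)).eval σ = 0 by omega]
    simp
  simp only [joinCond, Expr.eval_mul, mul_ne_zero_iff, Expr.eval_sub, Expr.eval_lit,
    hmem, modE_eval, Expr.eval_reg, Expr.eval_read, Expr.eval_add, nE_eval, h.tables.n_eq, h9, h10,
    hadj, ne_eq (Expr.eval σ (neE _ _)), neE_eval_eq_zero, h13, h14, closedE_eval h.tables]
  tauto

theorem stepProg_wp {q : MateState} {σ : State} (h : Loaded x W S q σ)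
    (hq : Reach (Adjacent x) x.n S q) (ht : q.t < x.n * (x.n + 1))
    (hL : (x.n + 2) ^ (x.n + 2) < 2 ^ L) (hL' : x.n * (x.n + 1) + 1 < 2 ^ L)
    {Q : State → Prop}
    (hQ : ∀ σ', Loaded x W S (q.next (Adjacent x) x.n S (σ.reg 11 % 2)) σ' → σ'.mem = σ.mem →
      (∀ r, r < 6 ∨ r = 11 ∨ r = 12 → σ'.reg r = σ.reg r) → Q σ') :
    stepProg.wp L Q σ := by
  have hv : q.t / (x.n + 1) < x.n := (Nat.div_lt_iff_lt_mul (by omega)).2 ht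
  have hs : q.t % (x.n + 1) < x.n + 1 := Nat.mod_lt _ (by omega)
  have hc := hq.c_le
  have hnL : x.n + 2 < 2 ^ L := (Nat.le_self_pow (by omega) _).trans_lt hL
  have hmv := h.holds.lt (q.t / (x.n + 1)) (by omega)
  have hms := h.holds.lt (q.t % (x.n + 1)) (by omega)
  unfold MateState.next at hQ
  set v := q.t / (x.n + 1) with hvdef
  set s := q.t % (x.n + 1) with hsdef
  refine assign_wp (v := v) (by simp only [Expr.eval_div, Expr.eval_add, Expr.eval_reg, nE_eval,
    Expr.eval_lit, h.holds.tables.n_eq, h.time, hvdef]) (by omega) fun σ₁ m₁ v₁ r₁ => ?_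
  refine assign_wp (v := s) (by simp only [modE_eval, Expr.eval_add, Expr.eval_reg, nE_eval,
    Expr.eval_lit, m₁, h.holds.tables.n_eq, r₁ 8 (by norm_num), h.time, hsdef]) (by omega)
    fun σ₂ m₂ v₂ r₂ => ?_
  have h₂ : Holds x W S q.m σ₂ := h.holds.congr (m₂.trans m₁)
    (by rw [r₂ _ (by norm_num), r₁ _ (by norm_num)])
    (by rw [r₂ _ (by norm_num), r₁ _ (by norm_num)])
  have h9 : σ₂.reg 9 = v := by rw [r₂ _ (by norm_num), v₁]
  refine assign_wp (v := q.m v) (by rw [h₂.digitE_eval] <;> rw [Expr.eval_reg, h9]; omega)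
    (by omega) fun σ₃ m₃ v₃ r₃ => ?_
  have h₃ : Holds x W S q.m σ₃ := h₂.congr m₃ (r₃ _ (by norm_num)) (r₃ _ (by norm_num))
  have e₃ : ∀ r, r ≠ 9 → r ≠ 10 → r ≠ 13 → σ₃.reg r = σ.reg r := fun r h1 h2 h3 => by
    rw [r₃ r h3, r₂ r h2, r₁ r h1]
  have k9 : σ₃.reg 9 = v := by rw [r₃ _ (by norm_num), h9]
  have k10 : σ₃.reg 10 = s := by rw [r₃ _ (by norm_num), v₂]
  have mm₃ : σ₃.mem = σ.mem := by rw [m₃, m₂, m₁]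
  -- the last command advances the time
  have last : ∀ (m' : ℕ → ℕ) (c' : ℕ) (σ' : State), Holds x W S m' σ' → σ'.reg 7 = c' →
      σ'.mem = σ.mem → (∀ r, r < 6 ∨ r = 8 ∨ r = 11 ∨ r = 12 → σ'.reg r = σ.reg r) →
      (∀ σ'', Loaded x W S ⟨m', c', q.t + 1⟩ σ'' → σ''.mem = σ.mem →
        (∀ r, r < 6 ∨ r = 11 ∨ r = 12 → σ''.reg r = σ.reg r) → Q σ'') →
      (Prog.assign 8 (.reg 8 + .lit 1)).wp L Q σ' := by
    intro m' c' σ' k1 k2 k3 k4 k5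
    refine assign_wp (v := q.t + 1) (by simp only [Expr.eval_add, Expr.eval_reg, Expr.eval_lit,
      k4 8 (by norm_num), h.time]) (by omega) fun σ'' m'' v'' r'' => ?_
    refine k5 σ'' ⟨k1.congr m'' (r'' _ (by norm_num)) (r'' _ (by norm_num)),
      (r'' _ (by norm_num)).trans k2, v''⟩ (m''.trans k3) fun r hr => ?_
    rw [r'' r (by omega), k4 r (by omega)]
  refine ⟨fun hlt => ?_, fun hge => ?_⟩
  · have hlt : s < x.n := by
      simp only [Expr.eval_sub, nE_eval, Expr.eval_reg, h₃.tables.n_eq, k10] at hlt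
      omega
    rw [if_pos hlt] at hQ
    refine assign_wp (v := q.m s) (by rw [h₃.digitE_eval] <;> rw [Expr.eval_reg, k10]; omega)
      (by omega) fun σ₄ m₄ v₄ r₄ => ?_
    have h₄ : Holds x W S q.m σ₄ := h₃.congr m₄ (r₄ _ (by norm_num)) (r₄ _ (by norm_num))
    have j9 : σ₄.reg 9 = v := by rw [r₄ _ (by norm_num), k9]
    have j10 : σ₄.reg 10 = s := by rw [r₄ _ (by norm_num), k10]
    have j13 : σ₄.reg 13 = q.m v := by rw [r₄ _ (by norm_num), v₃]
    have e₄ : ∀ r, r < 9 ∨ r = 11 ∨ r = 12 → σ₄.reg r = σ.reg r := fun r hr => by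
      rw [r₄ r (by omega), e₃ r (by omega) (by omega) (by omega)]
    have hcond := joinCond_eval h₄ hv hlt j9 j10 j13 v₄
    rw [e₄ 11 (by norm_num)] at hcond
    refine ⟨fun hj => ?_, fun hj => ?_⟩
    · rw [if_pos (hcond.1 hj)] at hQ
      refine joinProg_wp h₄ hv hlt j9 j10 j13 v₄ hL
        (by rw [e₄ 7 (by norm_num), h.edges]; omega) fun σ₅ h₅ c₅ m₅ r₅ => ?_
      refine last _ _ σ₅ h₅ (by rw [c₅, e₄ 7 (by norm_num), h.edges]) (by rw [m₅, m₄, mm₃])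
        (fun r hr => ?_) hQ
      rw [r₅ r (by omega) (by omega), e₄ r (by omega)]
    · rw [if_neg (fun hh => hcond.2 hh hj)] at hQ
      exact last _ _ σ₄ h₄ (by rw [e₄ 7 (by norm_num), h.edges]) (by rw [m₄, mm₃])
        (fun r hr => e₄ r (by omega)) hQ
  · have hge : ¬ s < x.n := by
      simp only [Expr.eval_sub, nE_eval, Expr.eval_reg, h₃.tables.n_eq, k10] at hge
      omega
    rw [if_neg hge] at hQ
    have hmem : (neE (.read 1 (.reg 9)) (.reg 1)).eval σ₃ = 0 ↔ v ∈ S := by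
      rw [neE_eval_eq_zero, ← h₃.tables.marks.iff, Expr.eval_read, Expr.eval_reg, Expr.eval_reg,
        k9, h₃.tables.marks.reg]
    refine ⟨fun hf => ?_, fun hf => ?_⟩
    · rw [if_neg (fun hh => hf (hmem.2 hh))] at hQ
      refine forgetProg_wp h₃ hv k9 v₃ hL fun σ₅ h₅ m₅ r₅ => ?_
      exact last _ _ σ₅ h₅ (by rw [r₅ 7 (by norm_num), e₃ 7 (by norm_num) (by norm_num)
        (by norm_num), h.edges]) (by rw [m₅, mm₃])
        (fun r hr => by rw [r₅ r (by omega), e₃ r (by omega) (by omega) (by omega)]) hQ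
    · rw [if_pos (hmem.1 hf)] at hQ
      exact last _ _ σ₃ h₃ (by rw [e₃ 7 (by norm_num) (by norm_num) (by norm_num), h.edges]) mm₃
        (fun r hr => by rw [e₃ r (by omega) (by omega) (by omega)]) hQ

end UPPAlgorithm

/-! ### The search through the reachable states -/

namespace UPPAlgorithm

open RAM

variable {x : UPPInstance} {W L M : ℕ} {S : Finset ℕ}

/-- The address under which a state is recorded as seen. -/
def MateState.key (n : ℕ) (q : MateState) : ℕ :=
  code (n + 2) (n + 2) q.m + (n + 2) ^ (n + 2) * (q.c + q.t * ((n + 2) * (n + 2)))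

theorem MateState.key_injective {n : ℕ} {q q' : MateState} (hm : IsMate n q.m)
    (hm' : IsMate n q'.m) (hc : q.c < (n + 2) * (n + 2)) (hc' : q'.c < (n + 2) * (n + 2))
    (h : q.key n = q'.key n) : q = q' := by
  have h1 := code_lt hm.lt
  have h2 := code_lt hm'.lt
  unfold MateState.key at h
  have e1 := congrArg (· % (n + 2) ^ (n + 2)) h
  simp only [Nat.add_mul_mod_self_left, Nat.mod_eq_of_lt h1, Nat.mod_eq_of_lt h2] at e1
  rw [e1, Nat.add_left_cancel_iff, Nat.mul_right_inj (by positivity)] at h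
  have e2 := congrArg (· % ((n + 2) * (n + 2))) h
  simp only [Nat.add_mul_mod_self_right, Nat.mod_eq_of_lt hc, Nat.mod_eq_of_lt hc'] at e2
  rw [e2, Nat.add_left_cancel_iff, Nat.mul_left_inj (by positivity)] at h
  have e3 : q.m = q'.m := by
    funext i
    by_cases hi : i < n + 2
    · exact code_inj hm.lt hm'.lt e1 i hi
    · rw [hm.fixed i (by omega), hm'.fixed i (by omega)]
  cases q; cases q'; simp_all

/-- Fills array `2` with powers of the base, and register `6` with the code of the identity. -/
def tableBody : Prog :=
  .seq (.store 2 (.reg 5 + .lit 1) (.read 2 (.reg 5) * baseE))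
    (.seq (.assign 6 (.reg 6 + .reg 5 * .read 2 (.reg 5))) (.assign 5 (.reg 5 + .lit 1)))

def tablePrep : Prog :=
  .seq (.store 2 (.lit 0) (.lit 1)) (.seq (.assign 5 (.lit 0)) (.assign 6 (.lit 0)))

/-- Starts the list of states with the initial state. Arrays `3`, `5` and `6` hold the components of
the listed states, array `4` marks the keys of the listed states, register `12` holds the length of
the list, and register `11` counts the steps taken from listed states. -/
def listPrep : Prog :=
  .seq (.store 3 (.lit 0) (.reg 6))
    (.seq (.store 4 (.reg 6) (.lit 1))
      (.seq (.assign 12 (.lit 1)) (.seq (.assign 11 (.lit 0)) (.assign 0 (.lit 0)))))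

/-- The key of the state in registers `6`, `7` and `8`. -/
def keyE : Expr :=
  .reg 6 + .read 2 (nE + .lit 2) * (.reg 7 + .reg 8 * (baseE * baseE))

/-- Appends the state in registers `6`, `7` and `8` to the list unless it has been seen. -/
def pushProg : Prog :=
  .ifNonzero (.read 4 keyE) .skip
    (.seq (.store 4 keyE (.lit 1))
      (.seq (.store 3 (.reg 12) (.reg 6))
        (.seq (.store 5 (.reg 12) (.reg 7))
          (.seq (.store 6 (.reg 12) (.reg 8)) (.assign 12 (.reg 12 + .lit 1))))))

def loadProg : Prog :=
  .seq (.assign 6 (.read 3 (.reg 11 / .lit 2)))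
    (.seq (.assign 7 (.read 5 (.reg 11 / .lit 2))) (.assign 8 (.read 6 (.reg 11 / .lit 2))))

/-- One step from a listed state, or the test for acceptance if it is final. -/
def searchBody : Prog :=
  .seq loadProg
    (.seq
      (.ifNonzero (nE * (nE + .lit 1) - .reg 8)
        (.seq stepProg pushProg)
        (.ifNonzero (nE - (.reg 7 + .read 0 (.lit 1))) .skip (.assign 0 (.lit 1))))
      (.assign 11 (.reg 11 + .lit 1)))

/-- The list of states in memory is `ℓ 0, …, ℓ (len - 1)`. -/
structure Listed (x : UPPInstance) (S : Finset ℕ) (ℓ : ℕ → MateState) (len : ℕ) (σ : State) :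
    Prop where
  len_eq : σ.reg 12 = len
  reach : ∀ i < len, Reach (Adjacent x) x.n S (ℓ i)
  mate : ∀ i < len, σ.mem 3 i = code (x.n + 2) (x.n + 2) (ℓ i).m
  edges : ∀ i < len, σ.mem 5 i = (ℓ i).c
  time : ∀ i < len, σ.mem 6 i = (ℓ i).t
  inj : ∀ i < len, ∀ j < len, ℓ i = ℓ j → i = j
  seen : ∀ y, σ.mem 4 y ≠ 0 ↔ ∃ i < len, (ℓ i).key x.n = y

theorem Listed.congr {ℓ : ℕ → MateState} {len : ℕ} {σ σ' : State} (h : Listed x S ℓ len σ)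
    (hr : σ'.reg 12 = σ.reg 12) (hm : σ'.mem = σ.mem) : Listed x S ℓ len σ' :=
  ⟨hr.trans h.len_eq, h.reach, by rw [hm]; exact h.mate, by rw [hm]; exact h.edges,
    by rw [hm]; exact h.time, h.inj, by rw [hm]; exact h.seen⟩

theorem Listed.len_le {ℓ : ℕ → MateState} {len : ℕ} {σ : State} (h : Listed x S ℓ len σ)
    {F : Finset MateState} (hF : ∀ q, Reach (Adjacent x) x.n S q → q ∈ F) : len ≤ F.card := by
  rw [← Finset.card_range len]
  exact Finset.card_le_card_of_injOn ℓ (fun i hi => hF _ (h.reach i (by simpa using hi)))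
    fun i hi j hj e => h.inj i (by simpa using hi) j (by simpa using hj) e

theorem pushProg_wp {q : MateState} {σ : State} {ℓ : ℕ → MateState} {len : ℕ}
    (hSn : ∀ i ∈ S, i < x.n) (h : Loaded x W S q σ) (hq : Reach (Adjacent x) x.n S q)
    (hℓ : Listed x S ℓ len σ) (hb : ∀ r, r = 6 ∨ r = 7 ∨ r = 8 → σ.reg r < 2 ^ L)
    (hL : len + 1 < 2 ^ L)
    {Q : State → Prop}
    (hQ : ∀ σ' ℓ' len', Tables x W S σ' → Listed x S ℓ' len' σ' → len ≤ len' →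
      (∀ i < len, ℓ' i = ℓ i) → (∃ i < len', ℓ' i = q) → (∀ r, r ≠ 12 → σ'.reg r = σ.reg r) →
      Q σ') :
    pushProg.wp L Q σ := by
  have htab := h.holds.tables
  have hkey : keyE.eval σ = q.key x.n := by
    simp only [keyE, baseE, MateState.key, Expr.eval_add, Expr.eval_mul, Expr.eval_reg,
      Expr.eval_read, nE_eval, Expr.eval_lit, htab.n_eq, htab.pow _ le_rfl, h.holds.reg, h.edges,
      h.time]
  have hc : ∀ q, Reach (Adjacent x) x.n S q → q.c < (x.n + 2) * (x.n + 2) := fun q hq => by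
    have := hq.c_le; have := hq.t_le; nlinarith
  have hkinj : ∀ q', Reach (Adjacent x) x.n S q' → q'.key x.n = q.key x.n → q' = q :=
    fun q' hq' e => MateState.key_injective (hq'.isMate hSn)
      (hq.isMate hSn) (hc _ hq') (hc _ hq) e
  refine ⟨fun hne => ?_, fun he => ?_⟩
  · rw [Expr.eval_read, hkey, hℓ.seen] at hne
    obtain ⟨i, hi, hik⟩ := hne
    exact hQ σ ℓ len htab hℓ le_rfl (fun _ _ => rfl) ⟨i, hi, hkinj _ (hℓ.reach i hi) hik⟩
      fun _ _ => rfl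
  · rw [Expr.eval_read, hkey] at he
    have hnew : ∀ i < len, ℓ i ≠ q := fun i hi e => (hℓ.seen _).2 ⟨i, hi, by rw [e]⟩ he
    simp only [Prog.wp, Expr.eval_lit, Expr.eval_reg, Expr.eval_add, hkey, State.setMem_reg]
    have hlen := hℓ.len_eq
    refine ⟨by omega, hb 6 (by simp), hb 7 (by simp), hb 8 (by simp), by omega, ?_⟩
    have hupd : ∀ i < len, Function.update ℓ len q i = ℓ i := fun i hi =>
      Function.update_of_ne hi.ne _ _
    refine hQ _ (Function.update ℓ len q) (len + 1) (htab.congr (by simp) fun a ha => ?_) ?_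
      (by omega) hupd ⟨len, by omega, by simp⟩ fun r hr => by simp [hr]
    · funext i
      simp [show a ≠ 3 by omega, show a ≠ 4 by omega, show a ≠ 5 by omega, show a ≠ 6 by omega]
    · have hsplit : ∀ i, i < len + 1 → i < len ∨ i = len := fun i hi => by omega
      refine ⟨by simp [hlen], fun i hi => ?_, fun i hi => ?_, fun i hi => ?_, fun i hi => ?_,
        fun i hi j hj e => ?_, fun y => ?_⟩
      · rcases hsplit i hi with hi | rfl
        · rw [hupd i hi]; exact hℓ.reach i hi
        · rw [Function.update_self]; exact hq
      · rcases hsplit i hi with hi | rfl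
        · rw [hupd i hi, ← hℓ.mate i hi]; simp [hlen, hi.ne]
        · rw [Function.update_self, ← h.holds.reg]; simp [hlen]
      · rcases hsplit i hi with hi | rfl
        · rw [hupd i hi, ← hℓ.edges i hi]; simp [hlen, hi.ne]
        · rw [Function.update_self, ← h.edges]; simp [hlen]
      · rcases hsplit i hi with hi | rfl
        · rw [hupd i hi, ← hℓ.time i hi]; simp [hlen, hi.ne]
        · rw [Function.update_self, ← h.time]; simp [hlen]
      · rcases hsplit i hi with hi | rfl <;> rcases hsplit j hj with hj | rfl
        · rw [hupd i hi, hupd j hj] at e; exact hℓ.inj i hi j hj e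
        · rw [hupd i hi, Function.update_self] at e; exact absurd e (hnew i hi)
        · rw [hupd j hj, Function.update_self] at e; exact absurd e.symm (hnew j hj)
        · rfl
      · have : ∀ z, (if y = q.key x.n then 1 else z) ≠ 0 ↔ y = q.key x.n ∨ z ≠ 0 := fun z => by
          split_ifs with h <;> simp [h]
        simp only [State.setReg_mem, State.setMem_mem, show (4 : ℕ) ≠ 6 by norm_num,
          show (4 : ℕ) ≠ 5 by norm_num, show (4 : ℕ) ≠ 3 by norm_num, false_and, if_false,
          true_and, this, hℓ.seen]
        constructor
        · rintro (rfl | ⟨i, hi, rfl⟩)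
          · exact ⟨len, by omega, by simp⟩
          · exact ⟨i, by omega, by rw [hupd i hi]⟩
        · rintro ⟨i, hi, rfl⟩
          rcases hsplit i hi with hi | rfl
          · exact .inr ⟨i, hi, by rw [hupd i hi]⟩
          · left; simp

/-- Invariant of the search: the steps numbered below register `11` have been taken, where step
`2 * i + b` is the step with bit `b` from the state `ℓ i`. -/
structure SearchInv (x : UPPInstance) (W : ℕ) (S : Finset ℕ) (σ : State) : Prop where
  tables : Tables x W S σ
  listed : ∃ (ℓ : ℕ → MateState) (len : ℕ), Listed x S ℓ len σ ∧ σ.reg 11 ≤ 2 * len ∧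
    (∃ i < len, ℓ i = ⟨id, 0, 0⟩) ∧
    (∀ j < σ.reg 11, (ℓ (j / 2)).t < x.n * (x.n + 1) →
      ∃ i < len, ℓ i = (ℓ (j / 2)).next (Adjacent x) x.n S (j % 2)) ∧
    (σ.reg 0 ≠ 0 ↔ ∃ j < σ.reg 11, (ℓ (j / 2)).t = x.n * (x.n + 1) ∧
      x.n ≤ (ℓ (j / 2)).c + x.k)

theorem searchBody_wp {σ : State} (hSn : ∀ i ∈ S, i < x.n)
    (hL : (x.n + 2) ^ (x.n + 2) < 2 ^ L) (hL' : x.n * (x.n + 1) + 1 < 2 ^ L)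
    (hM : 2 * M + 1 < 2 ^ L) {F : Finset MateState}
    (hF : ∀ q, Reach (Adjacent x) x.n S q → q ∈ F) (hFM : F.card ≤ M)
    (h : SearchInv x W S σ) (hlt : (Expr.lit 2 * .reg 12 - .reg 11).eval σ ≠ 0) :
    searchBody.wp L (fun σ' => SearchInv x W S σ' ∧ 2 * M - σ'.reg 11 < 2 * M - σ.reg 11) σ := by
  obtain ⟨htab, ℓ, len, hℓ, -, hstart, hclosed, hans⟩ := h
  have hlenM := (hℓ.len_le hF).trans hFM
  have hlt : σ.reg 11 < 2 * len := by
    simp only [Expr.eval_sub, Expr.eval_mul, Expr.eval_lit, Expr.eval_reg, hℓ.len_eq] at hlt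
    omega
  obtain ⟨j, hj⟩ : ∃ j, j = σ.reg 11 := ⟨_, rfl⟩
  rw [← hj] at hlt hclosed hans ⊢
  have hi : j / 2 < len := by omega
  obtain ⟨q, hqdef⟩ : ∃ q, q = ℓ (j / 2) := ⟨_, rfl⟩
  have hq : Reach (Adjacent x) x.n S q := hqdef ▸ hℓ.reach _ hi
  have hm := hq.isMate hSn
  refine assign_wp (v := code (x.n + 2) (x.n + 2) q.m) (by simp only [Expr.eval_read, Expr.eval_div,
    Expr.eval_reg, Expr.eval_lit, ← hj, hℓ.mate _ hi, hqdef]) ((code_lt hm.lt).trans hL)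
    fun σ₁ m₁ v₁ r₁ => ?_
  refine assign_wp (v := q.c) (by simp only [Expr.eval_read, Expr.eval_div, m₁, r₁ 11 (by norm_num),
    Expr.eval_reg, Expr.eval_lit, ← hj, hℓ.edges _ hi, hqdef])
    (by have := hq.c_le; have := hq.t_le; omega) fun σ₂ m₂ v₂ r₂ => ?_
  refine assign_wp (v := q.t) (by simp only [Expr.eval_read, Expr.eval_div, m₂, m₁,
    r₂ 11 (by norm_num), r₁ 11 (by norm_num), Expr.eval_reg, Expr.eval_lit, ← hj, hℓ.time _ hi,
    hqdef]) (by have := hq.t_le; omega) fun σ₃ m₃ v₃ r₃ => ?_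
  have mm₃ : σ₃.mem = σ.mem := by rw [m₃, m₂, m₁]
  have e₃ : ∀ r, r ≠ 6 → r ≠ 7 → r ≠ 8 → σ₃.reg r = σ.reg r := fun r h6 h7 h8 => by
    rw [r₃ r h8, r₂ r h7, r₁ r h6]
  have htab₃ : Tables x W S σ₃ := htab.congr (e₃ _ (by norm_num) (by norm_num) (by norm_num))
    fun a _ => by rw [mm₃]
  have hload : Loaded x W S q σ₃ := ⟨⟨htab₃, by
    rw [r₃ _ (by norm_num), r₂ _ (by norm_num), v₁], hm.lt⟩, by rw [r₃ _ (by norm_num), v₂], v₃⟩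
  have hℓ₃ : Listed x S ℓ len σ₃ := hℓ.congr (e₃ _ (by norm_num) (by norm_num) (by norm_num)) mm₃
  have hj₃ : σ₃.reg 11 = j := by rw [e₃ _ (by norm_num) (by norm_num) (by norm_num), hj]
  have h0₃ : σ₃.reg 0 = σ.reg 0 := e₃ _ (by norm_num) (by norm_num) (by norm_num)
  -- the last command advances the step counter
  have last : ∀ (σ' : State) (ℓ' : ℕ → MateState) (len' : ℕ), Tables x W S σ' →
      Listed x S ℓ' len' σ' → len ≤ len' → (∀ i < len, ℓ' i = ℓ i) → σ'.reg 11 = j →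
      (q.t < x.n * (x.n + 1) → ∃ i < len', ℓ' i = q.next (Adjacent x) x.n S (j % 2)) →
      (σ'.reg 0 ≠ 0 ↔ σ.reg 0 ≠ 0 ∨ q.t = x.n * (x.n + 1) ∧ x.n ≤ q.c + x.k) →
      (Prog.assign 11 (.reg 11 + .lit 1)).wp L (fun σ' => SearchInv x W S σ' ∧
        2 * M - σ'.reg 11 < 2 * M - j) σ' := by
    intro σ' ℓ' len' k1 k2 k3 k4 k5 k6 k7
    have hjj : ∀ i, i < j + 1 → i / 2 < len := fun i hi => by omega
    have hsplit : ∀ i, i < j + 1 → i < j ∨ i = j := fun i hi => by omega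
    refine assign_wp (v := j + 1) (by simp only [Expr.eval_add, Expr.eval_reg, Expr.eval_lit, k5])
      (by omega) fun σ'' m'' v'' r'' => ?_
    refine ⟨⟨k1.congr (r'' _ (by norm_num)) fun a _ => by rw [m''], ℓ', len',
      k2.congr (r'' _ (by norm_num)) m'', by omega, ?_, ?_, ?_⟩, by omega⟩
    · obtain ⟨i, hi, e⟩ := hstart
      exact ⟨i, by omega, by rw [k4 i hi, e]⟩
    · rw [v'']
      intro i hi ht
      rw [k4 _ (hjj i hi)] at ht ⊢
      rcases hsplit i hi with hi | rfl
      · obtain ⟨i', hi', e⟩ := hclosed i hi ht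
        exact ⟨i', by omega, by rw [k4 i' hi', e]⟩
      · rw [← hqdef] at ht ⊢
        exact k6 ht
    · rw [r'' _ (by norm_num), v'', k7, hans]
      constructor
      · rintro (⟨i, hi, h⟩ | h)
        · exact ⟨i, by omega, by rwa [k4 _ (hjj i (by omega))]⟩
        · exact ⟨j, by omega, by rwa [k4 _ (hjj j (by omega)), ← hqdef]⟩
      · rintro ⟨i, hi, h⟩
        rw [k4 _ (hjj i hi)] at h
        rcases hsplit i hi with hi | rfl
        · exact .inl ⟨i, hi, h⟩
        · rw [← hqdef] at h; exact .inr h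
  have htime : (nE * (nE + .lit 1) - .reg 8 : Expr).eval σ₃ = x.n * (x.n + 1) - q.t := by
    simp only [Expr.eval_sub, Expr.eval_mul, Expr.eval_add, nE_eval, Expr.eval_lit, Expr.eval_reg,
      htab₃.n_eq, v₃]
  refine ⟨fun hne => ?_, fun he => ?_⟩
  · rw [htime] at hne
    have ht : q.t < x.n * (x.n + 1) := by omega
    refine stepProg_wp hload hq ht hL hL' fun σ₄ h₄ m₄ r₄ => ?_
    rw [hj₃] at h₄
    have hq' : Reach (Adjacent x) x.n S (q.next (Adjacent x) x.n S (j % 2)) := .next _ hq ht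
    have hc' := hq'.c_le
    have ht' := hq'.t_le
    refine pushProg_wp hSn h₄ hq' (hℓ₃.congr (r₄ _ (by norm_num)) m₄) ?_ (by omega)
      fun σ₅ ℓ₅ len₅ t₅ l₅ le₅ ex₅ new₅ r₅ => ?_
    · rintro r (rfl | rfl | rfl)
      · rw [h₄.holds.reg]; exact (code_lt h₄.holds.lt).trans hL
      · rw [h₄.edges]; omega
      · rw [h₄.time]; omega
    · refine last σ₅ ℓ₅ len₅ t₅ l₅ le₅ ex₅ ?_ (fun _ => new₅) ?_
      · rw [r₅ _ (by norm_num), r₄ _ (by norm_num), hj₃]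
      · rw [r₅ _ (by norm_num), r₄ _ (by norm_num), h0₃]
        exact ⟨.inl, fun h => h.resolve_right fun h => by omega⟩
  · rw [htime] at he
    have ht : q.t = x.n * (x.n + 1) := by have := hq.t_le; omega
    have hk : (nE - (.reg 7 + .read 0 (.lit 1)) : Expr).eval σ₃ = x.n - (q.c + x.k) := by
      simp only [Expr.eval_sub, Expr.eval_add, nE_eval, Expr.eval_lit, Expr.eval_reg,
        Expr.eval_read, htab₃.n_eq, hload.edges, htab₃.input 1, encode_k]
    refine ⟨fun hne => ?_, fun he' => ?_⟩
    · rw [hk] at hne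
      refine last σ₃ ℓ len htab₃ hℓ₃ le_rfl (fun _ _ => rfl) hj₃ (fun h => by omega) ?_
      rw [h0₃]
      exact ⟨.inl, fun h => h.resolve_right fun h => by omega⟩
    · rw [hk] at he'
      refine assign_wp (v := 1) rfl (by omega) fun σ₄ m₄ v₄ r₄ => ?_
      refine last σ₄ ℓ len (htab₃.congr (r₄ _ (by norm_num)) fun a _ => by rw [m₄])
        (hℓ₃.congr (r₄ _ (by norm_num)) m₄) le_rfl (fun _ _ => rfl)
        ((r₄ _ (by norm_num)).trans hj₃) (fun h => by omega) ?_
      rw [v₄]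
      exact ⟨fun _ => .inr ⟨ht, by omega⟩, fun _ => one_ne_zero⟩

end UPPAlgorithm

/-! ### The complete program -/

namespace UPPAlgorithm

open RAM

variable {x : UPPInstance} {W L M : ℕ} {S : Finset ℕ}

def tableCond : Expr := nE + .lit 2 - .reg 5

def tableProg : Prog := .seq tablePrep (.whileNonzero tableCond tableBody)

/-- Running time of the construction of the tables. -/
def tableWeight (n : ℕ) : ℕ :=
  tablePrep.weight + (n + 2 + 1) * (tableCond.weight + 1 + tableBody.weight)

/-- Invariant of the construction of the tables. -/
structure TableInv (x : UPPInstance) (W : ℕ) (S : Finset ℕ) (σ : State) : Prop where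
  input : ∀ i, σ.mem 0 i = x.encode.getD i 0
  marks : Marks W S σ
  le : σ.reg 5 ≤ x.n + 2
  reg : σ.reg 6 = code (x.n + 2) (σ.reg 5) id
  pow : ∀ i ≤ σ.reg 5, σ.mem 2 i = (x.n + 2) ^ i
  empty : ∀ a, 3 ≤ a → ∀ i, σ.mem a i = 0

theorem code_id_lt {n i : ℕ} (hi : i ≤ n + 2) : code (n + 2) i id < (n + 2) ^ (n + 2) :=
  (code_lt fun j hj => by simp only [id]; omega).trans_le (Nat.pow_le_pow_right (by omega) hi)

theorem tableBody_wp {σ : State} (hL : (x.n + 2) ^ (x.n + 2) < 2 ^ L) (h : TableInv x W S σ)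
    (hlt : tableCond.eval σ ≠ 0) :
    tableBody.wp L (fun σ' => TableInv x W S σ' ∧
      x.n + 2 - σ'.reg 5 < x.n + 2 - σ.reg 5) σ := by
  obtain ⟨hin, hmarks, -, hreg, hpow, hemp⟩ := h
  have hn : σ.mem 0 0 = x.n := hin 0
  have hlt : σ.reg 5 < x.n + 2 := by
    simp only [tableCond, Expr.eval_sub, Expr.eval_add, nE_eval, Expr.eval_lit, Expr.eval_reg,
      hn] at hlt
    omega
  have hself : (x.n + 2) ≤ (x.n + 2) ^ (x.n + 2) := Nat.le_self_pow (by omega) _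
  have hnew : (x.n + 2) ^ (σ.reg 5) * (x.n + 2) < 2 ^ L := by
    rw [← pow_succ]
    exact (Nat.pow_le_pow_right (by omega) hlt).trans_lt hL
  have hcode : code (x.n + 2) (σ.reg 5) id + σ.reg 5 * (x.n + 2) ^ (σ.reg 5) =
      code (x.n + 2) (σ.reg 5 + 1) id := by
    rw [code, code, Finset.sum_range_succ]; rfl
  simp only [tableBody, Prog.wp, Expr.eval_add, Expr.eval_mul, Expr.eval_reg, Expr.eval_read,
    Expr.eval_lit, baseE, nE_eval, hn, hpow _ le_rfl, State.setMem_reg, State.setReg_reg,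
    State.setMem_mem, show σ.reg 5 ≠ σ.reg 5 + 1 by omega, and_false, if_false,
    hreg, hcode]
  refine ⟨hnew, (code_id_lt hlt).trans hL, by norm_num; omega, ⟨?_, ⟨?_, ?_, ?_⟩, ?_, ?_, ?_, ?_⟩,
    ?_⟩
  · simpa using hin
  · simpa using hmarks.reg
  · simpa using hmarks.iff
  · simpa using hmarks.le
  · simp; omega
  · simp
  · intro i hi
    simp only [State.setReg_reg, if_true] at hi
    norm_num at hi
    by_cases hi' : i = σ.reg 5 + 1
    · subst hi'; simp [pow_succ]
    · have := hpow i (by omega)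
      simp [hi', this]
  · intro a ha i
    simp [show a ≠ 2 by omega, hemp a ha]
  · simp; omega

theorem tableProg_runs {σ : State} (hL : (x.n + 2) ^ (x.n + 2) < 2 ^ L) (hb : Bounded L σ)
    (hc : Clean x σ) (hm : Marks W S σ) :
    Runs L tableProg σ (tableWeight x.n) fun σ' => Tables x W S σ' ∧
      σ'.reg 6 = code (x.n + 2) (x.n + 2) id ∧ ∀ a, 3 ≤ a → ∀ i, σ'.mem a i = 0 := by
  have h1 : 1 < 2 ^ L := (Nat.one_le_pow _ _ (by omega)).trans_lt hL
  have hprep : Runs L tablePrep σ tablePrep.weight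
      fun σ' => TableInv x W S σ' ∧ σ'.reg 5 = 0 := by
    refine Runs.of_wp hb ?_
    simp only [tablePrep, Prog.wp, Expr.eval_lit]
    refine ⟨h1, by omega, by omega, ⟨?_, ⟨?_, ?_, ?_⟩, by simp, by simp [code], ?_, ?_⟩, by simp⟩
    · simpa using hc.input
    · simpa using hm.reg
    · simpa using hm.iff
    · simpa using hm.le
    · intro i hi
      obtain rfl : i = 0 := by simpa using hi
      simp
    · intro a ha i
      simp [show a ≠ 2 by omega, hc.empty a (by omega)]
  refine hprep.seq fun σ₁ hb₁ ⟨h₁, h0⟩ => ?_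
  have hloop := Runs.while (L := L) (e := tableCond) (p := tableBody) (w := tableBody.weight)
    (TableInv x W S) (fun σ => x.n + 2 - σ.reg 5)
    (fun τ hbτ hτ he => Runs.of_wp hbτ (tableBody_wp hL hτ he)) hb₁ h₁
  simp only [h0, Nat.sub_zero] at hloop
  refine hloop.mono le_rfl fun σ₂ _ ⟨h₂, he⟩ => ?_
  simp only [tableCond, Expr.eval_sub, Expr.eval_add, nE_eval, Expr.eval_lit, Expr.eval_reg,
    h₂.input 0, encode_n] at he
  have h5 : σ₂.reg 5 = x.n + 2 := by have := h₂.le; omega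
  exact ⟨⟨h₂.input, h₂.marks, h5 ▸ h₂.pow⟩, by rw [h₂.reg, h5], h₂.empty⟩

def searchCond : Expr := .lit 2 * .reg 12 - .reg 11

def searchProg : Prog := .seq listPrep (.whileNonzero searchCond searchBody)

/-- Running time of the search through at most `M` states. -/
def searchWeight (M : ℕ) : ℕ :=
  listPrep.weight + (2 * M + 1) * (searchCond.weight + 1 + searchBody.weight)

theorem searchProg_runs {σ : State} (hSn : ∀ i ∈ S, i < x.n)
    (hScov : ∀ u v, Adjacent x u v → u ∈ S ∨ v ∈ S) (hb : Bounded L σ)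
    (hL : (x.n + 2) ^ (x.n + 2) < 2 ^ L) (hL' : x.n * (x.n + 1) + 1 < 2 ^ L)
    (hM : 2 * M + 1 < 2 ^ L) {F : Finset MateState}
    (hF : ∀ q, Reach (Adjacent x) x.n S q → q ∈ F) (hFM : F.card ≤ M)
    (ht : Tables x W S σ) (h6 : σ.reg 6 = code (x.n + 2) (x.n + 2) id)
    (hemp : ∀ a, 3 ≤ a → ∀ i, σ.mem a i = 0) :
    Runs L searchProg σ (searchWeight M) fun σ' => σ'.reg 0 ≠ 0 ↔ x.IsYes := by
  have h1 : 1 < 2 ^ L := by omega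
  have hprep : Runs L listPrep σ listPrep.weight
      fun σ' => SearchInv x W S σ' ∧ σ'.reg 11 = 0 := by
    refine Runs.of_wp hb ?_
    simp only [listPrep, Prog.wp, Expr.eval_lit, Expr.eval_reg, State.setMem_reg]
    refine ⟨hb.reg 6, h1, h1, by omega, by omega, ⟨ht.congr (by simp) fun a ha => ?_,
      fun _ => ⟨id, 0, 0⟩, 1, ⟨by simp, fun _ _ => .start, fun i hi => ?_, fun i hi => ?_,
        fun i hi => ?_, fun i hi j hj _ => by omega, fun y => ?_⟩, by simp, ⟨0, by omega, rfl⟩,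
      by simp, by simp⟩, by simp⟩
    · funext i
      simp [show a ≠ 3 by omega, show a ≠ 4 by omega]
    · obtain rfl : i = 0 := by omega
      simp [h6]
    · simp [hemp]
    · simp [hemp]
    · simp only [State.setReg_mem, State.setMem_mem, MateState.key, h6, hemp 4 (by norm_num)]
      constructor
      · intro h
        refine ⟨0, by omega, ?_⟩
        by_contra hne
        refine h ?_
        simp only [zero_mul, add_zero, mul_zero] at hne
        simp [Ne.symm hne]
      · rintro ⟨i, hi, rfl⟩
        simp
  refine hprep.seq fun σ₁ hb₁ ⟨h₁, h0⟩ => ?_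
  have hloop := Runs.while (L := L) (e := searchCond) (p := searchBody) (w := searchBody.weight)
    (SearchInv x W S) (fun σ => 2 * M - σ.reg 11)
    (fun τ hbτ hτ he => Runs.of_wp hbτ (searchBody_wp hSn hL hL' hM hF hFM hτ he)) hb₁ h₁
  simp only [h0, Nat.sub_zero] at hloop
  refine hloop.mono le_rfl fun σ₂ _ ⟨h₂, he⟩ => ?_
  obtain ⟨-, ℓ, len, hℓ, hle, hstart, hclosed, hans⟩ := h₂
  simp only [searchCond, Expr.eval_sub, Expr.eval_mul, Expr.eval_lit, Expr.eval_reg,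
    hℓ.len_eq] at he
  have h11 : σ₂.reg 11 = 2 * len := by omega
  rw [h11] at hclosed hans
  rw [hans]
  constructor
  · rintro ⟨j, hj, -, hk⟩
    obtain ⟨P, hP⟩ := (hℓ.reach (j / 2) (by omega)).exists_realizes Adjacent.lt_lt_ne
      Adjacent.symm hSn
    exact isYes_of_realizes hP hk
  · intro hyes
    obtain ⟨e, pos, E, he, hE, hk⟩ := exists_ordering_of_isYes hyes
    obtain ⟨q, ⟨i, hi, rfl⟩, hqt, hqc⟩ := Reach.exists_final Adjacent.lt_lt_ne Adjacent.symm hSn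
      hScov he (fun q => ∃ i < len, ℓ i = q) hstart (fun q _ ⟨i, hi, hiq⟩ hq b hb => by
        obtain ⟨i', hi', h⟩ := hclosed (2 * i + b) (by omega) (by
          rw [show (2 * i + b) / 2 = i by omega, hiq]; exact hq)
        rw [show (2 * i + b) / 2 = i by omega, show (2 * i + b) % 2 = b by omega, hiq] at h
        exact ⟨i', hi', h⟩) E hE
    refine ⟨2 * i, by omega, ?_⟩
    rw [show 2 * i / 2 = i by omega]
    exact ⟨hqt, by omega⟩

/-! ### The running time -/

/-- The algorithm. -/
def mainProg : Prog := .seq coverProg (.seq tableProg searchProg)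

/-- The bound on the number of states of the search. -/
def stateBound (n vc : ℕ) : ℕ :=
  (n * (n + 1) + 1) ^ 2 * ((vc + 2).factorial * 2 ^ (vc + 1))

/-- The number of bits that suffices on inputs of size `s`. -/
def bitBound (s : ℕ) : ℕ := s * s + 6 * s

theorem stateBound_lt (x : UPPInstance) :
    2 * stateBound x.n x.vc + 1 < 2 ^ bitBound (inputSize x.encode) := by
  have hs := n_mul_n_le_inputSize x
  have hvc := vc_le x
  set s := inputSize x.encode
  have hn : x.n + 2 ≤ s := by nlinarith [Nat.le_mul_self x.n]
  have hs2 : s < 2 ^ s := Nat.lt_two_pow_self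
  have h1 : (x.vc + 2).factorial ≤ 2 ^ (s * s) := by
    calc (x.vc + 2).factorial ≤ s.factorial := Nat.factorial_le (by omega)
      _ ≤ s ^ s := Nat.factorial_le_pow s
      _ ≤ (2 ^ s) ^ s := Nat.pow_le_pow_left hs2.le _
      _ = 2 ^ (s * s) := (pow_mul _ _ _).symm
  have h2 : 2 ^ (x.vc + 1) ≤ 2 ^ s := Nat.pow_le_pow_right (by norm_num) (by omega)
  have h3 : (x.n * (x.n + 1) + 1) ^ 2 ≤ 2 ^ (4 * s) := by
    calc (x.n * (x.n + 1) + 1) ^ 2 ≤ (s * s) ^ 2 := Nat.pow_le_pow_left (by nlinarith) _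
      _ = s ^ 4 := by ring
      _ ≤ (2 ^ s) ^ 4 := Nat.pow_le_pow_left hs2.le _
      _ = 2 ^ (4 * s) := by rw [← pow_mul, mul_comm]
  have h4 : stateBound x.n x.vc ≤ 2 ^ (s * s + 5 * s) := by
    calc stateBound x.n x.vc ≤ 2 ^ (4 * s) * (2 ^ (s * s) * 2 ^ s) :=
          Nat.mul_le_mul h3 (Nat.mul_le_mul h1 h2)
      _ = 2 ^ (s * s + 5 * s) := by rw [← pow_add, ← pow_add]; congr 1; ring
  have h5 : 2 ^ bitBound s = 2 ^ (s * s + 5 * s) * 2 ^ s := by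
    rw [bitBound, ← pow_add]; congr 1; ring
  have h6 : 4 ≤ 2 ^ s := Nat.pow_le_pow_right (n := 2) (by norm_num) (show 2 ≤ s by omega)
  have h7 : 1 ≤ 2 ^ (s * s + 5 * s) := Nat.one_le_two_pow
  rw [h5]
  nlinarith [Nat.mul_le_mul_left (2 ^ (s * s + 5 * s)) h6]

theorem mainProg_runs (x : UPPInstance) :
    Runs (bitBound (inputSize x.encode)) mainProg (init x.encode)
      (coverWeight x.n x.vc + (tableWeight x.n + searchWeight (stateBound x.n x.vc)))
      fun σ => σ.reg 0 ≠ 0 ↔ x.IsYes := by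
  have hM := stateBound_lt x
  have hs := n_mul_n_le_inputSize x
  have hvc := vc_le x
  set s := inputSize x.encode
  set L := bitBound s with hLdef
  have hn : x.n + 2 ≤ s := by nlinarith [Nat.le_mul_self x.n]
  have hs2 : s < 2 ^ s := Nat.lt_two_pow_self
  have hL : (x.n + 2) ^ (x.n + 2) < 2 ^ L := by
    calc (x.n + 2) ^ (x.n + 2) ≤ s ^ s :=
          (Nat.pow_le_pow_left hn _).trans (Nat.pow_le_pow_right (by omega) hn)
      _ < (2 ^ s) ^ s := Nat.pow_lt_pow_left hs2 (by omega)
      _ = 2 ^ (s * s) := (pow_mul _ _ _).symm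
      _ ≤ 2 ^ L := Nat.pow_le_pow_right (by norm_num) (by rw [hLdef, bitBound]; omega)
  have hsq : (x.n + 2) ^ 2 ≤ (x.n + 2) ^ (x.n + 2) := Nat.pow_le_pow_right (by omega) (by omega)
  have hL' : 2 ^ (x.vc + 1) ≤ 2 ^ L :=
    Nat.pow_le_pow_right (by norm_num) (by rw [hLdef, bitBound]; omega)
  have hb : Bounded L (init x.encode) :=
    bounded_init _ (by rw [hLdef, bitBound]; nlinarith)
  refine (coverProg_runs (by nlinarith) hL' hb).seq fun σ₁ hb₁ ⟨hc₁, W, S, hm₁, hS, hSn, hScov⟩ => ?_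
  refine (tableProg_runs hL hb₁ hc₁ hm₁).seq fun σ₂ hb₂ ⟨ht₂, h6, hemp⟩ => ?_
  obtain ⟨F, hF, hFc⟩ := Reach.exists_finset (A := Adjacent x) hSn
  refine searchProg_runs hSn hScov hb₂ hL (by nlinarith) hM hF (hFc.trans ?_) ht₂ h6 hemp
  exact Nat.mul_le_mul_left _ (Nat.mul_le_mul (Nat.factorial_le (by omega))
    (Nat.pow_le_pow_right (by norm_num) (by omega)))

open Polynomial in
theorem exists_polynomial : ∃ P : Polynomial ℕ, ∀ n vc s : ℕ, vc ≤ n → n * n + 2 ≤ s →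
    (coverWeight n vc + (tableWeight n + searchWeight (stateBound n vc))) * (bitBound s + 1) ≤
      vc.factorial * 2 ^ vc * P.eval s := by
  obtain ⟨a₁, ha₁⟩ : ∃ a, a = (Prog.assign 1 (.lit 1)).weight := ⟨_, rfl⟩
  obtain ⟨a₂, ha₂⟩ : ∃ a, a = (Expr.lit 1 - .reg 2).weight + 1 := ⟨_, rfl⟩
  obtain ⟨b₁, hb₁⟩ : ∃ a, a = roundPrep.weight := ⟨_, rfl⟩
  obtain ⟨b₂, hb₂⟩ : ∃ a, a = (nE * nE - .reg 4).weight + 1 + scanBody.weight := ⟨_, rfl⟩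
  obtain ⟨b₃, hb₃⟩ : ∃ a, a = (Prog.assign 1 (.reg 1 + (.lit 1 - .reg 2))).weight := ⟨_, rfl⟩
  obtain ⟨c₁, hc₁⟩ : ∃ a, a = tablePrep.weight := ⟨_, rfl⟩
  obtain ⟨c₂, hc₂⟩ : ∃ a, a = tableCond.weight + 1 + tableBody.weight := ⟨_, rfl⟩
  obtain ⟨d₁, hd₁⟩ : ∃ a, a = listPrep.weight := ⟨_, rfl⟩
  obtain ⟨d₂, hd₂⟩ : ∃ a, a = searchCond.weight + 1 + searchBody.weight := ⟨_, rfl⟩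
  refine ⟨(C a₁ + 2 * (C a₂ + (C b₁ + (X * C b₂ + C b₃))) + (C c₁ + (X + 1) * C c₂ +
    (C d₁ + (4 * X ^ 6 + 1) * C d₂))) * (X * X + 6 * X + 1), fun n vc s hvc hs => ?_⟩
  simp only [coverWeight, roundWeight, tableWeight, searchWeight, ← ha₁, ← ha₂, ← hb₁, ← hb₂,
    ← hb₃, ← hc₁, ← hc₂, ← hd₁, ← hd₂, bitBound, eval_mul, eval_add, eval_C, eval_X, eval_pow,
    eval_one, eval_ofNat]
  rw [← mul_assoc]
  refine Nat.mul_le_mul_right _ ?_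
  have hn : n + 2 ≤ s := by nlinarith [Nat.le_mul_self n]
  have h2f : 2 ^ (vc + 1) ≤ 2 * (vc.factorial * 2 ^ vc) := by
    rw [pow_succ, mul_comm]
    exact Nat.mul_le_mul_left _ (Nat.le_mul_of_pos_left _ vc.factorial_pos)
  have hM : stateBound n vc ≤ 2 * s ^ 6 * (vc.factorial * 2 ^ vc) := by
    have h3 : (n * (n + 1) + 1) ^ 2 ≤ (s * s) ^ 2 := Nat.pow_le_pow_left (by nlinarith) _
    have h4 : (vc + 2) * (vc + 1) ≤ s * s := Nat.mul_le_mul (by omega) (by omega)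
    calc stateBound n vc = (n * (n + 1) + 1) ^ 2 * (((vc + 2) * (vc + 1)) *
          (2 * (vc.factorial * 2 ^ vc))) := by
          rw [stateBound, Nat.factorial_succ, Nat.factorial_succ, pow_succ]; ring
      _ ≤ (s * s) ^ 2 * ((s * s) * (2 * (vc.factorial * 2 ^ vc))) :=
          Nat.mul_le_mul h3 (Nat.mul_le_mul_right _ h4)
      _ = 2 * s ^ 6 * (vc.factorial * 2 ^ vc) := by ring
  have hf : 1 ≤ vc.factorial * 2 ^ vc := Nat.mul_pos vc.factorial_pos (by positivity)
  generalize vc.factorial * 2 ^ vc = f at *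
  have t1 : a₁ ≤ f * a₁ := Nat.le_mul_of_pos_left _ hf
  have t2 : 2 ^ (vc + 1) * (a₂ + (b₁ + ((n * n + 1) * b₂ + b₃))) ≤
      2 * f * (a₂ + (b₁ + (s * b₂ + b₃))) := by
    refine Nat.mul_le_mul h2f ?_
    have := Nat.mul_le_mul_right b₂ (show n * n + 1 ≤ s by omega)
    omega
  have t3 : c₁ + (n + 2 + 1) * c₂ ≤ f * (c₁ + (s + 1) * c₂) := by
    refine le_trans ?_ (Nat.le_mul_of_pos_left _ hf)
    have := Nat.mul_le_mul_right c₂ (show n + 2 + 1 ≤ s + 1 by omega)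
    omega
  have t4 : d₁ + (2 * stateBound n vc + 1) * d₂ ≤ f * (d₁ + (4 * s ^ 6 + 1) * d₂) := by
    have h5 : 2 * stateBound n vc + 1 ≤ f * (4 * s ^ 6 + 1) := by nlinarith
    have h6 := Nat.mul_le_mul_right d₂ h5
    have h7 : d₁ ≤ f * d₁ := Nat.le_mul_of_pos_left _ hf
    rw [mul_add, ← mul_assoc]
    omega
  calc _ ≤ f * a₁ + 2 * f * (a₂ + (b₁ + (s * b₂ + b₃))) +
        (f * (c₁ + (s + 1) * c₂) + f * (d₁ + (4 * s ^ 6 + 1) * d₂)) :=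
        Nat.add_le_add (Nat.add_le_add t1 t2) (Nat.add_le_add t3 t4)
    _ = _ := by ring

theorem computable_factorial_mul_two_pow :
    Computable fun c : ℕ => Nat.factorial c * 2 ^ c := by
  have h : Primrec₂ fun k r : ℕ => 2 * (k + 1) * r :=
    Primrec.nat_mul.comp (Primrec.nat_mul.comp (Primrec.const 2) (Primrec.succ.comp Primrec.fst))
      Primrec.snd
  refine ((Primrec.nat_rec₁ 1 h).of_eq fun c => ?_).to_comp
  induction c with
  | zero => rfl
  | succ c ih =>
    rw [Nat.factorial_succ, pow_succ]
    simp only at ih ⊢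
    rw [ih]
    ring

theorem solvableInOStar : SolvableInOStar UPPInstance.encode UPPInstance.IsYes
    fun x => Nat.factorial x.vc * 2 ^ x.vc := by
  obtain ⟨P, hP⟩ := exists_polynomial
  refine ⟨mainProg, P, fun x => ?_⟩
  obtain ⟨σ, t, h1, h2, -, h3⟩ := mainProg_runs x
  exact ⟨σ, t, h1, h2.trans (hP _ _ _ (vc_le x) (n_mul_n_le_inputSize x)), h3⟩

end UPPAlgorithm

theorem mainTheorem8 :
    RAM.IsFPT UPPInstance.encode UPPInstance.IsYes UPPInstance.vc ∧
      RAM.SolvableInOStar UPPInstance.encode UPPInstance.IsYes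
        (fun x => Nat.factorial x.vc * 2 ^ x.vc) :=
  ⟨⟨_, UPPAlgorithm.computable_factorial_mul_two_pow, UPPAlgorithm.solvableInOStar⟩,
    UPPAlgorithm.solvableInOStar⟩
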